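/- Let $\Omega\subset\mathbb R^d$ be a bounded Lipschitz domain (open, connected, locally the strict epigraph of a Lipschitz function near every boundary point), $x_0\in\Omega$, and let $s_*,\bar s,\psi_i\in L^\infty(\Omega)$ ($i\ge 1$), where $s_*\ge 0$. Write $b_i=\|\psi_i\|_{L^\infty(\Omega)}$ and assume that $b_i\le c\,i^{-p}$ for all $i\ge1$, with constants $c>0$ and $p>1$. Let $U=\{u\in\mathbb R^{\mathbb N}:\sum_{i\ge1}|u_i|b_i<\infty\}$, equipped with the product $\sigma$-algebra restricted to $U$ and with the prior $\gamma$, the restriction to $U$ of $\bigotimes_{i\ge1}\mathcal N(0,1)$. For $u\in U$ and $J\ge1$ put $$s(x,u)=s_*(x)+\exp\Big(\bar s(x)+\sum_{i=1}^\infty u_i\psi_i(x)\Big),\qquad s^J(x,u)=s_*(x)+\exp\Big(\bar s(x)+\sum_{i=1}^J u_i\psi_i(x)\Big),$$ and assume that $s(\cdot,u)$ is continuous on $\overline\Omega$ for every $u\in U$. Let $T(\cdot,u)$ and $T^J(\cdot,u)$ be the viscosity solutions of the eikonal equations $|\nabla T|=s(\cdot,u)$ and $|\nabla T^J|=s^J(\cdot,u)$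 with $T(x_0,u)=T^J(x_0,u)=0$ and the Soner boundary condition $\nabla T\cdot n\ge 0$, $\nabla T^J\cdot n\ge0$ on $\partial\Omega$; that is, they are continuous on $\overline\Omega$, viscosity subsolutions in $\Omega\setminus\{x_0\}$ and viscosity supersolutions on $\overline\Omega\setminus\{x_0\}$ (up to the boundary). Let $x^1,\dots,x^N\in\overline\Omega$, let $G(u)=(T(x^1,u),\dots,T(x^N,u))$ and $G^J(u)=(T^J(x^1,u),\dots,T^J(x^N,u))$, and let $\Sigma\in\mathbb R^{N\times N}$ be symmetric positive definite, with $|v|_\Sigma^2=v^\top\Sigma^{-1}v$. For data $\delta\in\mathbb R^N$ let $\gamma^\delta$ and $\gamma^{J,\delta}$ be the posteriors, whose densities with respect to $\gamma$ are proportional to $\exp(-\tfrac12|\delta-G(u)|_\Sigma^2)$ and $\exp(-\tfrac12|\delta-G^J(u)|_\Sigma^2)$ and have total mass one. Let $$d_{\mathrm{Hell}}(\alpha,\beta)^2=\frac12\int_U\Big(\sqrt{\tfrac{d\alpha}{d\gamma}}-\sqrt{\tfrac{d\beta}{d\gamma}}\Big)^2d\gamma .$$ Then for every $r$ there is a constant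 $C(r)$, independent of $\delta$ and $J$, such that for all $\delta$ with $|\delta|<r$ and all $J\ge1$ the measures $\gamma^\delta$ and $\gamma^{J,\delta}$ are well-defined probability measures and $$d_{\mathrm{Hell}}(\gamma^{J,\delta},\gamma^\delta)\le C(r)\,J^{-q},\qquad q=p-1 .$$ -/

import Mathlib

open scoped ContDiff

noncomputable section

namespace LogNormalEikonal

/-- A bounded Lipschitz domain in `ℝ^d`: a bounded, connected, non-empty open set which, near every
boundary point and in a suitable orthonormal frame with last axis `ν`, is the strict epigraph of a
Lipschitz function `g` of the component orthogonal to `ν`. -/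
structure IsLipschitzDomain {d : ℕ} (Ω : Set (EuclideanSpace ℝ (Fin d))) : Prop where
  isOpen : IsOpen Ω
  isConnected : IsConnected Ω
  isBounded : Bornology.IsBounded Ω
  locally_epigraph : ∀ z ∈ frontier Ω,
    ∃ (ρ : ℝ) (ν : EuclideanSpace ℝ (Fin d)) (K : NNReal) (g : EuclideanSpace ℝ (Fin d) → ℝ),
      0 < ρ ∧ ‖ν‖ = 1 ∧ LipschitzWith K g ∧
        ∀ y ∈ Metric.ball z ρ, (y ∈ Ω ↔ g (y - inner ℝ ν y • ν) < inner ℝ ν y)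

/-- `T` is a (continuous) viscosity solution of the eikonal equation `|∇T| = s` on `closure Ω`,
with point source `T x₀ = 0` and with the Soner boundary condition `∇T · n ≥ 0` on the boundary
understood in the viscosity sense: `T` is a subsolution in `Ω \ {x₀}` and a supersolution
on `closure Ω \ {x₀}`, up to the boundary. -/
structure IsEikonalSolution {d : ℕ} (Ω : Set (EuclideanSpace ℝ (Fin d)))
    (x₀ : EuclideanSpace ℝ (Fin d)) (s T : EuclideanSpace ℝ (Fin d) → ℝ) : Prop where
  continuousOn : ContinuousOn T (closure Ω)
  source : T x₀ = 0
  subsolution : ∀ φ : EuclideanSpace ℝ (Fin d) → ℝ, ContDiff ℝ ∞ φ → ∀ x ∈ Ω \ {x₀},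
    IsLocalMax (fun y => T y - φ y) x → ‖gradient φ x‖ ≤ s x
  supersolution : ∀ φ : EuclideanSpace ℝ (Fin d) → ℝ, ContDiff ℝ ∞ φ → ∀ x ∈ closure Ω \ {x₀},
    IsLocalMinOn (fun y => T y - φ y) (closure Ω) x → s x ≤ ‖gradient φ x‖

/-- The norm `‖f‖_{L^∞(Ω)}`. -/
def supNorm {d : ℕ} (Ω : Set (EuclideanSpace ℝ (Fin d)))
    (f : EuclideanSpace ℝ (Fin d) → ℝ) : ℝ :=
  (MeasureTheory.eLpNorm f ⊤ (MeasureTheory.volume.restrict Ω)).toReal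

/-- The parameter space `U = {u ∈ ℝ^ℕ : ∑ᵢ |uᵢ| ‖ψᵢ‖_{L^∞(Ω)} < ∞}`. -/
def paramSpace {d : ℕ} (Ω : Set (EuclideanSpace ℝ (Fin d)))
    (ψ : ℕ → EuclideanSpace ℝ (Fin d) → ℝ) : Set (ℕ → ℝ) :=
  {u | Summable fun i => |u i| * supNorm Ω (ψ i)}

/-- The prior on `U`: the restriction to `U` of the countable product of standard Gaussians. -/
def prior {d : ℕ} (Ω : Set (EuclideanSpace ℝ (Fin d)))
    (ψ : ℕ → EuclideanSpace ℝ (Fin d) → ℝ) : MeasureTheory.Measure (paramSpace Ω ψ) :=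
  (MeasureTheory.Measure.infinitePi fun _ : ℕ => ProbabilityTheory.gaussianReal 0 1).comap
    Subtype.val

/-- The log-normal slowness `s(x,u) = s_*(x) + exp(s̄(x) + ∑ᵢ uᵢ ψᵢ(x))`. -/
def slowness {d : ℕ} (sStar sBar : EuclideanSpace ℝ (Fin d) → ℝ)
    (ψ : ℕ → EuclideanSpace ℝ (Fin d) → ℝ) (u : ℕ → ℝ) (x : EuclideanSpace ℝ (Fin d)) : ℝ :=
  sStar x + Real.exp (sBar x + ∑' i, u i * ψ i x)

/-- The slowness with only the first `J` terms of the expansion. -/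
def truncSlowness {d : ℕ} (sStar sBar : EuclideanSpace ℝ (Fin d) → ℝ)
    (ψ : ℕ → EuclideanSpace ℝ (Fin d) → ℝ) (J : ℕ) (u : ℕ → ℝ)
    (x : EuclideanSpace ℝ (Fin d)) : ℝ :=
  sStar x + Real.exp (sBar x + ∑ i ∈ Finset.range J, u i * ψ i x)

/-- The forward map `u ↦ (T(x¹,u), …, T(x^N,u))`. -/
def forwardMap {d N : ℕ} {V : Type*} (pts : Fin N → EuclideanSpace ℝ (Fin d))
    (T : V → EuclideanSpace ℝ (Fin d) → ℝ) (u : V) : EuclideanSpace ℝ (Fin N) :=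
  WithLp.toLp 2 fun k => T u (pts k)

/-- The squared weighted norm `|v|²_Σ = |Σ^{-1/2} v|² = vᵀ Σ⁻¹ v`. -/
def covNormSq {N : ℕ} (cov : Matrix (Fin N) (Fin N) ℝ) (v : EuclideanSpace ℝ (Fin N)) : ℝ :=
  v.ofLp ⬝ᵥ (cov⁻¹.mulVec v.ofLp)

/-- The mismatch function `½ |δ - G(u)|²_Σ`. -/
def potential {N : ℕ} {V : Type*} (cov : Matrix (Fin N) (Fin N) ℝ)
    (G : V → EuclideanSpace ℝ (Fin N)) (δ : EuclideanSpace ℝ (Fin N)) (u : V) : ℝ :=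
  1 / 2 * covNormSq cov (δ - G u)

/-- The posterior: the probability measure with density proportional to `exp (-Φ)` with respect
to the prior `γ`, that is `dγ^δ/dγ (u) = exp (-Φ(u)) / ∫ exp (-Φ) dγ`. -/
def posterior {V : Type*} [MeasurableSpace V] (γ : MeasureTheory.Measure V) (Φ : V → ℝ) :
    MeasureTheory.Measure V :=
  γ.tilted fun u => -Φ u

/-- The Hellinger distance, computed with the reference measure `γ`. -/
def hellingerDist {V : Type*} [MeasurableSpace V] (γ α β : MeasureTheory.Measure V) : ℝ :=
  Real.sqrt (1 / 2 *
    ∫ u, (Real.sqrt (α.rnDeriv γ u).toReal - Real.sqrt (β.rnDeriv γ u).toReal) ^ 2 ∂γ)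

end LogNormalEikonal

end

noncomputable section
namespace LogNormalEikonal

open Filter Topology MeasureTheory ProbabilityTheory

/-! The eikonal equation is positively homogeneous, so comparison is multiplicative: if `s₁ ≤ κ *
s₂` on `closure Ω`, then `T₁ ≤ κ * T₂` (`IsEikonalSolution.le_mul_of_le`, by Soner's doubling of
variables with a shift into the domain). Log-normal slownesses satisfy such an inequality with `κ =
exp (paramDist Ω ψ u v)`, because the exponents differ by at most the weighted `ℓ¹` distance and
`s_* ≥ 0`.

Write `A = ∑ |u_i| b_i` and `R = ∑_{i ≥ J} |u_i| b_i` (indices from 0). Comparison with the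
parameter `0` bounds travel times by a multiple of `exp A`; comparison of `u` with its truncation
bounds their difference by a multiple of `R * exp (2 * A)`. The potentials then differ by at most `P
* R * exp (3 * A)`.

The Hellinger distance is controlled by the `L²(γ)` distance of the potentials
(`hellingerDist_posterior_le`), so what remains is to show that `R ^ 2 * exp (6 * A)` has mean `O(ρ
^ 2)`, where `ρ = c / (p - 1) * J ^ (-(p - 1))` bounds the tail sum of the `b_i`. It is at most `ρ ^
2 * exp (2 / ρ * R + 6 * A)`, whose exponent is a weighted sum of the `|u_i|` with total weight at
most `2 + 6 * ∑ b_i`. Jensen's inequality (`integrable_exp_tsum_and_integral_le`) bounds its mean by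
a one-dimensional Gaussian integral that does not depend on `J`. -/

/-! ### Geometry of Lipschitz domains. -/

/-- Uniform interior cone property: small steps in a direction close to `η` lead from
`closure Ω` into `Ω`. -/
theorem IsLipschitzDomain.exists_inward_direction {d : ℕ} {Ω : Set (EuclideanSpace ℝ (Fin d))}
    (hΩ : IsLipschitzDomain Ω) {z : EuclideanSpace ℝ (Fin d)} (hz : z ∈ closure Ω) :
    ∃ (η : EuclideanSpace ℝ (Fin d)) (ε : ℝ), 0 < ε ∧ ∀ y ∈ closure Ω, ‖y - z‖ < ε →
      ∀ t : ℝ, 0 < t → t < ε → ∀ e : EuclideanSpace ℝ (Fin d), ‖e‖ < ε → y + t • (η + e) ∈ Ω := by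
  by_cases hzΩ : z ∈ Ω
  · obtain ⟨ρ, hρ, hball⟩ := Metric.isOpen_iff.1 hΩ.isOpen z hzΩ
    refine ⟨0, min 1 (ρ / 2), by positivity, fun y _ hyz t ht htε e he => hball ?_⟩
    rw [lt_min_iff] at hyz htε he
    rw [Metric.mem_ball, dist_eq_norm]
    calc ‖y + t • (0 + e) - z‖ = ‖(y - z) + t • e‖ := by congr 1; rw [zero_add]; abel
      _ ≤ ‖y - z‖ + t * ‖e‖ := by
        refine (norm_add_le _ _).trans ?_
        rw [norm_smul, Real.norm_of_nonneg ht.le]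
      _ < ρ := by nlinarith [norm_nonneg e]
  · have hfr : z ∈ frontier Ω := by
      rw [hΩ.isOpen.frontier_eq]
      exact ⟨hz, hzΩ⟩
    obtain ⟨ρ, ν, K, g, hρ, hν, hg, hepi⟩ := hΩ.locally_epigraph z hfr
    have hK : (0 : ℝ) ≤ K := K.2
    -- The bounds `1` and `ρ / 4` keep the moved point in the ball of the chart; `1 / (2 * K + 2)`
    -- makes the gain in height, at least `t * (1 - ‖e‖)`, exceed the variation of `g`, at most `2 *
    -- K * t * ‖e‖`.
    refine ⟨ν, min (min 1 (ρ / 4)) (1 / (2 * K + 2)), by positivity,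
      fun y hy hyz t ht htε e he => ?_⟩
    simp only [lt_min_iff] at hyz htε he
    obtain ⟨⟨-, hyz⟩, -⟩ := hyz
    obtain ⟨⟨ht1, htρ⟩, -⟩ := htε
    obtain ⟨⟨he1, heρ⟩, heK⟩ := he
    have hyball : y ∈ Metric.ball z ρ := by
      rw [Metric.mem_ball, dist_eq_norm]; linarith
    have hcontl : Continuous fun y : EuclideanSpace ℝ (Fin d) => g (y - inner ℝ ν y • ν) := by
      have := hg.continuous
      fun_prop
    have hcontr : Continuous fun y : EuclideanSpace ℝ (Fin d) => inner ℝ ν y := by fun_prop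
    -- On the closure the epigraph inequality is only weak; strictness comes from moving by `t > 0`.
    have hyle : g (y - inner ℝ ν y • ν) ≤ inner ℝ ν y := by
      have hycl : y ∈ closure (Ω ∩ Metric.ball z ρ) := by
        rw [Set.inter_comm]
        exact Metric.isOpen_ball.inter_closure ⟨hyball, hy⟩
      have hsub : closure (Ω ∩ Metric.ball z ρ) ⊆
          {y | g (y - inner ℝ ν y • ν) ≤ inner ℝ ν y} :=
        closure_minimal (fun w hw => ((hepi w hw.2).1 hw.1).le) (isClosed_le hcontl hcontr)
      exact hsub hycl
    have hinner : |inner ℝ ν e| ≤ ‖e‖ := by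
      simpa [hν] using abs_real_inner_le_norm ν e
    set y' := y + t • (ν + e) with hy'
    have hy'ball : y' ∈ Metric.ball z ρ := by
      rw [Metric.mem_ball, dist_eq_norm]
      calc ‖y' - z‖ = ‖(y - z) + t • (ν + e)‖ := by rw [hy']; congr 1; abel
        _ ≤ ‖y - z‖ + t * (‖ν‖ + ‖e‖) := by
          refine (norm_add_le _ _).trans ?_
          rw [norm_smul, Real.norm_of_nonneg ht.le]
          gcongr
          exact norm_add_le _ _
        _ < ρ := by rw [hν]; nlinarith [norm_nonneg e]
    rw [hepi y' hy'ball]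
    have hνν : inner ℝ ν ν = (1 : ℝ) := by simp [hν]
    have hinn' : inner ℝ ν y' = inner ℝ ν y + t * (1 + inner ℝ ν e) := by
      rw [hy', inner_add_right, inner_smul_right, inner_add_right, hνν]
    have hdist : dist (y' - inner ℝ ν y' • ν) (y - inner ℝ ν y • ν) ≤ t * (2 * ‖e‖) := by
      rw [dist_eq_norm]
      have : y' - inner ℝ ν y' • ν - (y - inner ℝ ν y • ν) = t • (e - inner ℝ ν e • ν) := by
        rw [hinn', hy']; module
      rw [this, norm_smul, Real.norm_of_nonneg ht.le]
      gcongr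
      refine (norm_sub_le _ _).trans ?_
      rw [norm_smul, hν, Real.norm_eq_abs]
      linarith
    have hgl := hg.dist_le_mul (y' - inner ℝ ν y' • ν) (y - inner ℝ ν y • ν)
    have hgl' := (le_abs_self _).trans (hgl.trans (mul_le_mul_of_nonneg_left hdist hK))
    have heK' : ‖e‖ * (2 * K + 2) < 1 := by
      rwa [lt_div_iff₀ (by positivity)] at heK
    have hpos : 0 < t * (1 + inner ℝ ν e - 2 * K * ‖e‖) := by
      apply mul_pos ht
      have := (abs_le.1 hinner).1
      nlinarith [norm_nonneg e]
    rw [hinn'] at hgl' ⊢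
    nlinarith

/-! ### Comparison principle for viscosity solutions. -/

/-- Freezing either variable of the doubled penalty leaves a function of this form, so it supplies
both test functions. -/
theorem contDiff_two_parabolas {F : Type*} [NormedAddCommGroup F] [InnerProductSpace ℝ F]
    (A B : ℝ) (p q : F) : ContDiff ℝ ∞ fun y : F => A * ‖y - p‖ ^ 2 + B * ‖y - q‖ ^ 2 := by
  have h (p : F) : ContDiff ℝ ∞ fun y : F => ‖y - p‖ ^ 2 :=
    (contDiff_id.sub contDiff_const).norm_sq ℝ
  exact (contDiff_const.mul (h p)).add (contDiff_const.mul (h q))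

theorem gradient_two_parabolas {F : Type*} [NormedAddCommGroup F] [InnerProductSpace ℝ F]
    [CompleteSpace F] (A B : ℝ) (p q x : F) :
    gradient (fun y : F => A * ‖y - p‖ ^ 2 + B * ‖y - q‖ ^ 2) x
      = (2 * A) • (x - p) + (2 * B) • (x - q) := by
  apply HasGradientAt.gradient
  rw [hasGradientAt_iff_hasFDerivAt]
  have h (p : F) : HasFDerivAt (fun y : F => ‖y - p‖ ^ 2) (2 • innerSL ℝ (x - p)) x := by
    simpa using ((hasFDerivAt_id x).sub_const p).norm_sq
  refine (((h p).const_mul A).add ((h q).const_mul B)).congr_fderiv ?_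
  ext v
  simp
  ring

/-- Comparison principle for the state-constrained eikonal equation with strictly ordered
right-hand sides. -/
theorem IsEikonalSolution.le_mul_of_lt {d : ℕ} {Ω : Set (EuclideanSpace ℝ (Fin d))}
    (hΩ : IsLipschitzDomain Ω) {x₀ : EuclideanSpace ℝ (Fin d)}
    {s₁ s₂ T₁ T₂ : EuclideanSpace ℝ (Fin d) → ℝ}
    (hs₁ : ContinuousOn s₁ (closure Ω)) (hs₂ : ContinuousOn s₂ (closure Ω))
    (hT₁ : IsEikonalSolution Ω x₀ s₁ T₁) (hT₂ : IsEikonalSolution Ω x₀ s₂ T₂)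
    {κ : ℝ} (hκ : 0 < κ) (hlt : ∀ z ∈ closure Ω, s₁ z < κ * s₂ z) :
    ∀ x ∈ closure Ω, T₁ x ≤ κ * T₂ x := by
  intro x hx
  by_contra! hcon
  set K := closure Ω with hKdef
  have hK : IsCompact K := hΩ.isBounded.isCompact_closure
  have hfc : ContinuousOn (fun y => T₁ y - κ * T₂ y) K :=
    hT₁.continuousOn.sub (continuousOn_const.mul hT₂.continuousOn)
  obtain ⟨z, hz, hzmax⟩ := hK.exists_isMaxOn ⟨x, hx⟩ hfc
  have hzmax' : ∀ y ∈ K, T₁ y - κ * T₂ y ≤ T₁ z - κ * T₂ z := fun y hy => hzmax hy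
  have hfz : 0 < T₁ z - κ * T₂ z := by linarith [hzmax' x hx]
  have hzx₀ : z ≠ x₀ := by
    rintro rfl
    rw [hT₁.source, hT₂.source] at hfz
    simp at hfz
  obtain ⟨η, ε, hε, hcone⟩ := hΩ.exists_inward_direction hz
  have hcone0 : ∀ t : ℝ, 0 < t → t < ε → z + t • η ∈ Ω := fun t h1 h2 => by
    simpa using hcone z hz (by simpa using hε) t h1 h2 0 (by simpa using hε)
  set t : ℕ → ℝ := fun n => ε / 2 / (n + 1) with ht
  have htpos : ∀ n, 0 < t n := fun n => by positivity
  have htlt : ∀ n, t n < ε := fun n => by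
    have : t n ≤ ε / 2 := div_le_self (by positivity) (by linarith [n.cast_nonneg (α := ℝ)])
    linarith
  have ht0 : Tendsto t atTop (𝓝 0) := by
    have := (tendsto_one_div_add_atTop_nhds_zero_nat (𝕜 := ℝ)).const_mul (ε / 2)
    simpa [ht, div_eq_mul_inv] using this
  -- The shift `t n • η` pushes the first variable off the boundary, since subsolutions are tested
  -- only inside `Ω`. With the weight `(t n)⁻¹ ^ 2` the penalty is `‖e n‖ ^ 2`, where `X n = Y n + t
  -- n • (η + e n)`. The term `‖w.2 - z‖ ^ 2` forces convergence to the chosen maximum point `z`.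
  have hmax : ∀ n, ∃ w ∈ K ×ˢ K, IsMaxOn (fun w : _ × _ => T₁ w.1 - κ * T₂ w.2
      - ((t n)⁻¹ ^ 2 * ‖w.1 - w.2 - t n • η‖ ^ 2 + ‖w.2 - z‖ ^ 2)) (K ×ˢ K) w := by
    intro n
    refine (hK.prod hK).exists_isMaxOn ⟨(z, z), hz, hz⟩ ?_
    have h1 : ContinuousOn (fun w : EuclideanSpace ℝ (Fin d) × EuclideanSpace ℝ (Fin d) =>
        T₁ w.1) (K ×ˢ K) := hT₁.continuousOn.comp continuousOn_fst fun w hw => hw.1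
    have h2 : ContinuousOn (fun w : EuclideanSpace ℝ (Fin d) × EuclideanSpace ℝ (Fin d) =>
        T₂ w.2) (K ×ˢ K) := hT₂.continuousOn.comp continuousOn_snd fun w hw => hw.2
    exact (h1.sub (continuousOn_const.mul h2)).sub (by fun_prop)
  choose w hwK hwmax using hmax
  set X : ℕ → EuclideanSpace ℝ (Fin d) := fun n => (w n).1 with hX
  set Y : ℕ → EuclideanSpace ℝ (Fin d) := fun n => (w n).2 with hY
  have hXK : ∀ n, X n ∈ K := fun n => (hwK n).1
  have hYK : ∀ n, Y n ∈ K := fun n => (hwK n).2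
  have hmax' : ∀ n, ∀ x ∈ K, ∀ y ∈ K, T₁ x - κ * T₂ y
      - ((t n)⁻¹ ^ 2 * ‖x - y - t n • η‖ ^ 2 + ‖y - z‖ ^ 2) ≤ T₁ (X n) - κ * T₂ (Y n)
      - ((t n)⁻¹ ^ 2 * ‖X n - Y n - t n • η‖ ^ 2 + ‖Y n - z‖ ^ 2) :=
    fun n x hx y hy => hwmax n (Set.mk_mem_prod hx hy)
  set e : ℕ → EuclideanSpace ℝ (Fin d) := fun n => (t n)⁻¹ • (X n - Y n - t n • η) with he
  have hXY : ∀ n, X n = Y n + t n • (η + e n) := fun n => by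
    simp only [he, smul_add, smul_smul, mul_inv_cancel₀ (htpos n).ne', one_smul]
    abel
  have hen : ∀ n, ‖e n‖ ^ 2 = (t n)⁻¹ ^ 2 * ‖X n - Y n - t n • η‖ ^ 2 := fun n => by
    simp only [he]
    rw [norm_smul, mul_pow, Real.norm_of_nonneg (inv_nonneg.2 (htpos n).le)]
  -- The competitor is `(z + t n • η, z)`, for which the first penalty term vanishes.
  have hpen : ∀ n, ‖e n‖ ^ 2 + ‖Y n - z‖ ^ 2 ≤
      T₁ (X n) - κ * T₂ (Y n) - (T₁ (z + t n • η) - κ * T₂ z) := fun n => by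
    have := hmax' n _ (subset_closure (hcone0 _ (htpos n) (htlt n))) z hz
    rw [← hen] at this
    simp at this
    linarith
  obtain ⟨C₁, hC₁⟩ := hK.exists_bound_of_continuousOn hT₁.continuousOn
  obtain ⟨C₂, hC₂⟩ := hK.exists_bound_of_continuousOn hT₂.continuousOn
  simp only [Real.norm_eq_abs] at hC₁ hC₂
  have hebd : ∀ n, ‖e n‖ ≤ 2 * C₁ + 2 * κ * C₂ + 1 := fun n => by
    have h1 := (abs_le.1 (hC₁ _ (hXK n))).2
    have h2 := (abs_le.1 (hC₂ _ (hYK n))).1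
    have h3 := (abs_le.1 (hC₁ _ (subset_closure (hcone0 _ (htpos n) (htlt n))))).1
    have h4 := (abs_le.1 (hC₂ _ hz)).2
    have h5 := hpen n
    nlinarith [sq_nonneg (‖Y n - z‖), sq_nonneg (‖e n‖ - 1), mul_le_mul_of_nonneg_left h2 hκ.le,
      mul_le_mul_of_nonneg_left h4 hκ.le]
  have hXY0 : Tendsto (fun n => X n - Y n) atTop (𝓝 0) := by
    have h1 : Tendsto (fun n => t n * (‖η‖ + (2 * C₁ + 2 * κ * C₂ + 1))) atTop (𝓝 0) := by
      simpa using ht0.mul_const (‖η‖ + (2 * C₁ + 2 * κ * C₂ + 1))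
    refine squeeze_zero_norm (fun n => ?_) h1
    rw [hXY n, add_sub_cancel_left, norm_smul, Real.norm_of_nonneg (htpos n).le]
    gcongr
    exact (norm_add_le _ _).trans (by gcongr; exact hebd n)
  have hdT : Tendsto (fun n => T₁ (X n) - T₁ (Y n)) atTop (𝓝 0) := by
    have huc := hK.uniformContinuousOn_of_continuous hT₁.continuousOn
    rw [Metric.uniformContinuousOn_iff] at huc
    rw [Metric.tendsto_atTop] at hXY0 ⊢
    intro a ha
    obtain ⟨δ, hδ, hd⟩ := huc a ha
    obtain ⟨n₀, hn₀⟩ := hXY0 δ hδ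
    refine ⟨n₀, fun n hn => ?_⟩
    have h1 := hd _ (hXK n) _ (hYK n) (by simpa [dist_eq_norm] using hn₀ n hn)
    simpa [dist_eq_norm] using h1
  have hmn : Tendsto (fun n => T₁ (z + t n • η)) atTop (𝓝 (T₁ z)) := by
    have h1 : Tendsto (fun n => z + t n • η) atTop (𝓝[K] z) := by
      refine tendsto_nhdsWithin_iff.2 ⟨?_, Eventually.of_forall fun n =>
        subset_closure (hcone0 _ (htpos n) (htlt n))⟩
      simpa using (ht0.smul_const η).const_add z
    exact (hT₁.continuousOn z hz).tendsto.comp h1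
  -- Maximality of `z` on the diagonal, used at `Y n`, leaves only increments of `T₁` over vanishing
  -- distances.
  have hpen0 : Tendsto (fun n => ‖e n‖ ^ 2 + ‖Y n - z‖ ^ 2) atTop (𝓝 0) := by
    have h1 : Tendsto (fun n => (T₁ (X n) - T₁ (Y n)) + (T₁ z - T₁ (z + t n • η))) atTop
        (𝓝 0) := by simpa using hdT.add (hmn.const_sub (T₁ z))
    refine squeeze_zero (fun n => by positivity) (fun n => ?_) h1
    linarith [hpen n, hzmax' _ (hYK n)]
  have hsq {a : ℕ → ℝ} (ha : ∀ n, 0 ≤ a n) (hle : ∀ n, a n ^ 2 ≤ ‖e n‖ ^ 2 + ‖Y n - z‖ ^ 2) :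
      Tendsto a atTop (𝓝 0) := by
    have h1 := (squeeze_zero (fun n => sq_nonneg (a n)) hle hpen0).sqrt
    simpa [Real.sqrt_sq, ha] using h1
  have he0 : Tendsto (fun n => ‖e n‖) atTop (𝓝 0) :=
    hsq (fun _ => norm_nonneg _) fun n => by linarith [sq_nonneg ‖Y n - z‖]
  have hYz : Tendsto (fun n => ‖Y n - z‖) atTop (𝓝 0) :=
    hsq (fun _ => norm_nonneg _) fun n => by linarith [sq_nonneg ‖e n‖]
  have hY0 : Tendsto Y atTop (𝓝 z) := tendsto_iff_norm_sub_tendsto_zero.2 hYz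
  have hX0 : Tendsto X atTop (𝓝 z) := by simpa using hXY0.add hY0
  have hkey : ∀ᶠ n in atTop, κ * s₂ (Y n) ≤ s₁ (X n) + 2 * ‖Y n - z‖ := by
    filter_upwards [hX0.eventually_ne hzx₀, hY0.eventually_ne hzx₀, he0.eventually_lt_const hε,
      hYz.eventually_lt_const hε] with n hXx₀ hYx₀ heε hYε
    have hXΩ : X n ∈ Ω := by
      rw [hXY n]
      exact hcone _ (hYK n) hYε _ (htpos n) (htlt n) _ heε
    -- The second variable is frozen. As `X n` lies in the open set `Ω`, the maximum over `closure
    -- Ω` is an unconstrained local maximum.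
    have hsub := hT₁.subsolution _ (contDiff_two_parabolas ((t n)⁻¹ ^ 2) 0
      (Y n + t n • η) 0) (X n) ⟨hXΩ, hXx₀⟩ (by
        filter_upwards [hΩ.isOpen.mem_nhds hXΩ] with y hy
        have := hmax' n y (subset_closure hy) (Y n) (hYK n)
        simp only [sub_sub] at this ⊢
        linarith)
    have hsup := hT₂.supersolution _ (contDiff_two_parabolas (-(κ⁻¹ * (t n)⁻¹ ^ 2)) (-κ⁻¹)
      (X n - t n • η) z) (Y n) ⟨hYK n, hYx₀⟩ (by
        filter_upwards [self_mem_nhdsWithin] with y hy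
        have h1 := hmax' n (X n) (hXK n) y hy
        have h2 (y : EuclideanSpace ℝ (Fin d)) :
            ‖X n - y - t n • η‖ = ‖y - (X n - t n • η)‖ := by
          rw [← norm_neg]; congr 1; abel
        rw [h2, h2] at h1
        refine le_of_mul_le_mul_left ?_ hκ
        have h3 (a A B : ℝ) : κ * (a - (-(κ⁻¹ * (t n)⁻¹ ^ 2) * A + -κ⁻¹ * B))
            = κ * a + ((t n)⁻¹ ^ 2 * A + B) := by field_simp; ring
        rw [h3, h3]
        linarith)
    rw [gradient_two_parabolas] at hsub hsup
    have hp1 : (2 * (t n)⁻¹ ^ 2) • (X n - (Y n + t n • η)) + ((2 : ℝ) * 0) • (X n - 0)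
        = (2 * (t n)⁻¹) • e n := by
      simp only [he, smul_smul, sub_sub, mul_zero, zero_smul, add_zero]
      congr 1; ring
    -- Up to the factor `κ⁻¹`, this gradient differs from the subsolution's only by `2 • (Y n - z)`;
    -- the large term `(2 * (t n)⁻¹) • e n` is common to both and drops out.
    have hp2 : (2 * -(κ⁻¹ * (t n)⁻¹ ^ 2)) • (Y n - (X n - t n • η)) + (2 * -κ⁻¹) • (Y n - z)
        = κ⁻¹ • ((2 * (t n)⁻¹) • e n - (2 : ℝ) • (Y n - z)) := by
      simp only [he]; module
    rw [hp1] at hsub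
    rw [hp2, norm_smul, Real.norm_of_nonneg (inv_nonneg.2 hκ.le)] at hsup
    have h4 : κ * s₂ (Y n) ≤ ‖(2 * (t n)⁻¹) • e n - (2 : ℝ) • (Y n - z)‖ := by
      have := mul_le_mul_of_nonneg_left hsup hκ.le
      rwa [mul_inv_cancel_left₀ hκ.ne'] at this
    have h5 := norm_sub_le ((2 * (t n)⁻¹) • e n) ((2 : ℝ) • (Y n - z))
    have h6 : ‖(2 : ℝ) • (Y n - z)‖ = 2 * ‖Y n - z‖ := by rw [norm_smul]; norm_num
    linarith
  have hs₂l : Tendsto (fun n => κ * s₂ (Y n)) atTop (𝓝 (κ * s₂ z)) :=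
    ((hs₂ z hz).tendsto.comp (tendsto_nhdsWithin_iff.2
      ⟨hY0, Eventually.of_forall hYK⟩)).const_mul κ
  have hs₁l : Tendsto (fun n => s₁ (X n) + 2 * ‖Y n - z‖) atTop (𝓝 (s₁ z)) := by
    simpa using ((hs₁ z hz).tendsto.comp (tendsto_nhdsWithin_iff.2
      ⟨hX0, Eventually.of_forall hXK⟩)).add (hYz.const_mul 2)
  exact absurd (le_of_tendsto_of_tendsto hs₂l hs₁l hkey) (not_le.2 (hlt z hz))

/-- Positivity of `s₂` makes the inequality strict for every `κ' > κ`; then `κ'` decreases to `κ`.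
-/
theorem IsEikonalSolution.le_mul_of_le {d : ℕ} {Ω : Set (EuclideanSpace ℝ (Fin d))}
    (hΩ : IsLipschitzDomain Ω) {x₀ : EuclideanSpace ℝ (Fin d)}
    {s₁ s₂ T₁ T₂ : EuclideanSpace ℝ (Fin d) → ℝ}
    (hs₁ : ContinuousOn s₁ (closure Ω)) (hs₂ : ContinuousOn s₂ (closure Ω))
    (hpos : ∀ z ∈ closure Ω, 0 < s₂ z)
    (hT₁ : IsEikonalSolution Ω x₀ s₁ T₁) (hT₂ : IsEikonalSolution Ω x₀ s₂ T₂)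
    {κ : ℝ} (hκ : 0 < κ) (hle : ∀ z ∈ closure Ω, s₁ z ≤ κ * s₂ z) :
    ∀ x ∈ closure Ω, T₁ x ≤ κ * T₂ x := by
  intro x hx
  have h1 : ∀ κ' ∈ Set.Ioi κ, T₁ x ≤ κ' * T₂ x := fun κ' hκ' =>
    hT₁.le_mul_of_lt hΩ hs₁ hs₂ hT₂ (hκ.trans hκ')
      (fun z hz => (hle z hz).trans_lt (mul_lt_mul_of_pos_right hκ' (hpos z hz))) x hx
  have h2 : Tendsto (fun κ' => κ' * T₂ x) (𝓝[>] κ) (𝓝 (κ * T₂ x)) :=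
    ((continuous_id.mul continuous_const).tendsto κ).mono_left nhdsWithin_le_nhds
  exact ge_of_tendsto h2 (eventually_of_mem self_mem_nhdsWithin h1)

/-! ### Dependence of the slowness on the parameter. -/

section Slowness

variable {d : ℕ} {Ω : Set (EuclideanSpace ℝ (Fin d))}
  {sStar sBar : EuclideanSpace ℝ (Fin d) → ℝ} {ψ : ℕ → EuclideanSpace ℝ (Fin d) → ℝ}

theorem supNorm_nonneg (f : EuclideanSpace ℝ (Fin d) → ℝ) : 0 ≤ supNorm Ω f :=
  ENNReal.toReal_nonneg

theorem ae_abs_le_supNorm {f : EuclideanSpace ℝ (Fin d) → ℝ}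
    (hf : MemLp f ⊤ (volume.restrict Ω)) :
    ∀ᵐ x ∂volume.restrict Ω, |f x| ≤ supNorm Ω f := by
  filter_upwards [ae_le_eLpNormEssSup (f := f) (μ := volume.restrict Ω)] with x hx
  rw [← eLpNorm_exponent_top] at hx
  have := ENNReal.toReal_mono hf.eLpNorm_lt_top.ne hx
  simpa [supNorm] using this

/-- A property that holds almost everywhere in an open set holds on a dense subset of it. -/
theorem mem_closure_of_ae_restrict (hΩ : IsOpen Ω) {P : EuclideanSpace ℝ (Fin d) → Prop}
    (hP : ∀ᵐ x ∂volume.restrict Ω, P x) {x : EuclideanSpace ℝ (Fin d)} (hx : x ∈ closure Ω) :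
    x ∈ closure {y ∈ Ω | P y} := by
  rw [mem_closure_iff] at hx ⊢
  intro V hV hxV
  obtain ⟨y, hyV, hyΩ⟩ := hx V hV hxV
  have hpos : volume (V ∩ Ω) ≠ 0 := ((hV.inter hΩ).measure_pos volume ⟨y, hyV, hyΩ⟩).ne'
  by_contra hne
  rw [Set.not_nonempty_iff_eq_empty] at hne
  rw [ae_restrict_iff' hΩ.measurableSet] at hP
  refine hpos (measure_mono_null (fun w hw => ?_) hP)
  intro hPw
  have : w ∈ V ∩ {y ∈ Ω | P y} := ⟨hw.1, hw.2, hPw hw.2⟩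
  simp [hne] at this

theorem finite_support_mem_paramSpace {u : ℕ → ℝ} {n : ℕ} (hu : ∀ i, n ≤ i → u i = 0) :
    u ∈ paramSpace Ω ψ :=
  summable_of_ne_finset_zero (s := Finset.range n) fun i hi => by
    rw [hu i (by simpa using hi)]; simp

theorem zero_mem_paramSpace : (0 : ℕ → ℝ) ∈ paramSpace Ω ψ :=
  finite_support_mem_paramSpace (n := 0) fun _ _ => rfl

theorem single_mem_paramSpace (i : ℕ) (t : ℝ) :
    (Pi.single i t : ℕ → ℝ) ∈ paramSpace Ω ψ :=
  finite_support_mem_paramSpace (n := i + 1) fun j hj =>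
    Pi.single_eq_of_ne (show j ≠ i by omega) _

theorem slowness_single (i : ℕ) (t : ℝ) (x : EuclideanSpace ℝ (Fin d)) :
    slowness sStar sBar ψ (Pi.single i t) x
      = sStar x + Real.exp (sBar x) * Real.exp (t * ψ i x) := by
  rw [slowness, tsum_eq_single i fun j hj => by simp [Pi.single_eq_of_ne hj], Pi.single_eq_same,
    Real.exp_add]

theorem abs_exp_sub_one_le_exp_abs (a : ℝ) : |Real.exp a - 1| ≤ Real.exp |a| := by
  rw [abs_le]
  have h1 := Real.exp_pos a
  have h2 := Real.one_le_exp (abs_nonneg a)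
  have h3 := Real.exp_le_exp.2 (le_abs_self a)
  constructor <;> linarith

/-- Continuity of all the slowness functions upgrades the essential bound on `ψ i` in `Ω` to a
pointwise bound on `closure Ω`. -/
theorem abs_le_supNorm_of_continuousOn_slowness (hΩ : IsOpen Ω)
    (hsBar : MemLp sBar ⊤ (volume.restrict Ω)) (hψ : ∀ i, MemLp (ψ i) ⊤ (volume.restrict Ω))
    (hcont : ∀ u ∈ paramSpace Ω ψ, ContinuousOn (slowness sStar sBar ψ u) (closure Ω))
    (i : ℕ) {x : EuclideanSpace ℝ (Fin d)} (hx : x ∈ closure Ω) :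
    |ψ i x| ≤ supNorm Ω (ψ i) := by
  set b := supNorm Ω (ψ i) with hb
  set M := supNorm Ω sBar with hM
  have hxS := mem_closure_of_ae_restrict hΩ
    ((ae_abs_le_supNorm hsBar).and (ae_abs_le_supNorm (hψ i))) hx
  -- Neither `sBar` nor `ψ i` need be continuous, but a difference of two slownesses is: it cancels
  -- `sStar`, and its bound on the dense good set extends to `x`.
  have hbound (t : ℝ) :
      Real.exp (sBar x) * |Real.exp (t * ψ i x) - 1| ≤ Real.exp M * Real.exp (|t| * b) := by
    set g : EuclideanSpace ℝ (Fin d) → ℝ := fun y =>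
      |slowness sStar sBar ψ (Pi.single i t) y - slowness sStar sBar ψ (Pi.single i 0) y| with hg
    have hgeq (y) : g y = Real.exp (sBar y) * |Real.exp (t * ψ i y) - 1| := by
      simp only [hg, slowness_single]
      rw [add_sub_add_left_eq_sub, ← mul_sub, abs_mul, Real.abs_exp]
      simp
    have hgc : ContinuousOn g (closure Ω) :=
      ((hcont _ (single_mem_paramSpace i t)).sub (hcont _ (single_mem_paramSpace i 0))).abs
    rw [← hgeq]
    have hmem : g x ∈ closure (g '' {y ∈ Ω | |sBar y| ≤ M ∧ |ψ i y| ≤ b}) :=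
      ((hgc x hx).mono fun y hy => subset_closure hy.1).mem_closure_image hxS
    refine closure_minimal (t := Set.Iic (Real.exp M * Real.exp (|t| * b))) ?_ isClosed_Iic hmem
    rintro _ ⟨y, ⟨-, hy1, hy2⟩, rfl⟩
    rw [Set.mem_Iic, hgeq]
    gcongr
    · exact (le_abs_self _).trans hy1
    · refine (abs_exp_sub_one_le_exp_abs _).trans (Real.exp_le_exp.2 ?_)
      rw [abs_mul]
      gcongr
  by_contra! hlt
  have hb0 : 0 ≤ b := supNorm_nonneg _
  -- Choosing the sign of `t` to match `ψ i x` compares the growth rates `|ψ i x|` and `b` for large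
  -- `τ`; an excess of the former would be bounded by a constant over `τ`.
  have hgrow (τ : ℝ) (hτ : 0 ≤ τ) :
      τ * (|ψ i x| - b) ≤ Real.exp (M - sBar x) + 1 := by
    have h1 : Real.exp (sBar x) * (Real.exp (τ * |ψ i x|) - 1)
        ≤ Real.exp M * Real.exp (τ * b) := by
      rcases abs_choice (ψ i x) with h | h
      · have h2 := hbound τ
        rw [abs_of_nonneg hτ] at h2
        rw [h]
        exact (mul_le_mul_of_nonneg_left (le_abs_self _) (Real.exp_pos _).le).trans h2
      · have h2 := hbound (-τ)
        rw [abs_neg, abs_of_nonneg hτ, neg_mul_comm] at h2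
        rw [h]
        exact (mul_le_mul_of_nonneg_left (le_abs_self _) (Real.exp_pos _).le).trans h2
    have h3 : Real.exp (τ * |ψ i x|) = Real.exp (τ * (|ψ i x| - b)) * Real.exp (τ * b) := by
      rw [← Real.exp_add]; congr 1; ring
    have h4 : Real.exp M = Real.exp (M - sBar x) * Real.exp (sBar x) := by
      rw [← Real.exp_add]; congr 1; ring
    rw [h3, h4, mul_comm (Real.exp (M - sBar x)), mul_assoc] at h1
    have h5 := le_of_mul_le_mul_left h1 (Real.exp_pos _)
    have h6 : 1 ≤ Real.exp (τ * b) := Real.one_le_exp (by positivity)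
    have h7 : Real.exp (τ * (|ψ i x| - b)) ≤ Real.exp (M - sBar x) + 1 := by
      refine le_of_mul_le_mul_right ?_ (Real.exp_pos (τ * b))
      linarith
    linarith [Real.add_one_le_exp (τ * (|ψ i x| - b))]
  have hpos : 0 < |ψ i x| - b := by linarith
  -- This `τ` turns the bound into `E + 2 ≤ E + 1`, where `E = exp (M - sBar x)`.
  have := hgrow ((Real.exp (M - sBar x) + 2) / (|ψ i x| - b)) (by positivity)
  rw [div_mul_cancel₀ _ hpos.ne'] at this
  linarith

/-- The weighted `ℓ¹` distance of two parameter sequences. -/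
def paramDist (Ω : Set (EuclideanSpace ℝ (Fin d))) (ψ : ℕ → EuclideanSpace ℝ (Fin d) → ℝ)
    (u v : ℕ → ℝ) : ℝ :=
  ∑' i, |u i - v i| * supNorm Ω (ψ i)

theorem paramDist_nonneg (u v : ℕ → ℝ) : 0 ≤ paramDist Ω ψ u v :=
  tsum_nonneg fun _ => mul_nonneg (abs_nonneg _) (supNorm_nonneg _)

theorem paramDist_comm (u v : ℕ → ℝ) : paramDist Ω ψ u v = paramDist Ω ψ v u := by
  simp only [paramDist, abs_sub_comm]

theorem summable_paramDist {u v : ℕ → ℝ} (hu : u ∈ paramSpace Ω ψ) (hv : v ∈ paramSpace Ω ψ) :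
    Summable fun i => |u i - v i| * supNorm Ω (ψ i) := by
  refine Summable.of_nonneg_of_le
    (fun i => mul_nonneg (abs_nonneg _) (supNorm_nonneg _)) (fun i => ?_) (Summable.add hu hv)
  rw [← add_mul]
  exact mul_le_mul_of_nonneg_right (abs_sub _ _) (supNorm_nonneg _)

theorem summable_expansion {x : EuclideanSpace ℝ (Fin d)} (hψx : ∀ i, |ψ i x| ≤ supNorm Ω (ψ i))
    {u : ℕ → ℝ} (hu : u ∈ paramSpace Ω ψ) : Summable fun i => u i * ψ i x := by
  refine Summable.of_norm_bounded hu fun i => ?_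
  rw [Real.norm_eq_abs, abs_mul]
  exact mul_le_mul_of_nonneg_left (hψx i) (abs_nonneg _)

/-- The factor multiplies the exponential part exactly as needed and, being at least `1`, only
enlarges the nonnegative `sStar x`. -/
theorem slowness_le_exp_paramDist_mul {x : EuclideanSpace ℝ (Fin d)} (hx : 0 ≤ sStar x)
    (hψx : ∀ i, |ψ i x| ≤ supNorm Ω (ψ i)) {u v : ℕ → ℝ} (hu : u ∈ paramSpace Ω ψ)
    (hv : v ∈ paramSpace Ω ψ) :
    slowness sStar sBar ψ u x
      ≤ Real.exp (paramDist Ω ψ u v) * slowness sStar sBar ψ v x := by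
  have hdiff : ∑' i, u i * ψ i x ≤ paramDist Ω ψ u v + ∑' i, v i * ψ i x := by
    rw [← sub_le_iff_le_add, ← (summable_expansion hψx hu).tsum_sub (summable_expansion hψx hv)]
    refine ((summable_expansion hψx hu).sub (summable_expansion hψx hv)).tsum_le_tsum
      (fun i => ?_) (summable_paramDist hu hv)
    rw [← sub_mul]
    refine (le_abs_self _).trans ?_
    rw [abs_mul]
    exact mul_le_mul_of_nonneg_left (hψx i) (abs_nonneg _)
  have h1 : 1 ≤ Real.exp (paramDist Ω ψ u v) := Real.one_le_exp (paramDist_nonneg _ _)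
  rw [slowness, slowness, mul_add, ← Real.exp_add]
  exact add_le_add (le_mul_of_one_le_left hx h1) (Real.exp_le_exp.2 (by linarith))

theorem slowness_pos {x : EuclideanSpace ℝ (Fin d)} (hx : 0 ≤ sStar x) (u : ℕ → ℝ) :
    0 < slowness sStar sBar ψ u x :=
  add_pos_of_nonneg_of_pos hx (Real.exp_pos _)

/-- The parameter sequence with all but the first `J` terms set to zero. -/
def truncParam (J : ℕ) (u : ℕ → ℝ) (i : ℕ) : ℝ :=
  if i < J then u i else 0

theorem truncParam_mem_paramSpace (J : ℕ) (u : ℕ → ℝ) : truncParam J u ∈ paramSpace Ω ψ :=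
  finite_support_mem_paramSpace (n := J) fun i hi => if_neg (by omega)

/-- Truncating the expansion is the same as moving the parameter inside `paramSpace Ω ψ`, so the
stability estimate also covers the truncated problem. -/
theorem slowness_truncParam (J : ℕ) (u : ℕ → ℝ) :
    slowness sStar sBar ψ (truncParam J u) = truncSlowness sStar sBar ψ J u := by
  ext x
  rw [slowness, truncSlowness, tsum_eq_sum (s := Finset.range J) fun i hi => by
    rw [truncParam, if_neg (by simpa using hi), zero_mul]]
  congr 3
  exact Finset.sum_congr rfl fun i hi => by rw [truncParam, if_pos (by simpa using hi)]

theorem paramDist_self_zero_eq (u : ℕ → ℝ) :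
    paramDist Ω ψ u 0 = ∑' i, |u i| * supNorm Ω (ψ i) := by
  simp [paramDist]

theorem paramDist_truncParam_eq (J : ℕ) (u : ℕ → ℝ) :
    paramDist Ω ψ u (truncParam J u)
      = ∑' i, |u i| * (if i < J then 0 else supNorm Ω (ψ i)) := by
  refine tsum_congr fun i => ?_
  by_cases h : i < J <;> simp [truncParam, h]

theorem paramDist_truncParam_le {u : ℕ → ℝ} (hu : u ∈ paramSpace Ω ψ) (J : ℕ) :
    paramDist Ω ψ u (truncParam J u) ≤ paramDist Ω ψ u 0 := by
  refine (summable_paramDist hu (truncParam_mem_paramSpace J u)).tsum_le_tsum (fun i => ?_)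
    (summable_paramDist hu zero_mem_paramSpace)
  refine mul_le_mul_of_nonneg_right ?_ (supNorm_nonneg _)
  by_cases h : i < J <;> simp [truncParam, h]

theorem paramDist_truncParam_zero_le {u : ℕ → ℝ} (hu : u ∈ paramSpace Ω ψ) (J : ℕ) :
    paramDist Ω ψ (truncParam J u) 0 ≤ paramDist Ω ψ u 0 := by
  refine (summable_paramDist (truncParam_mem_paramSpace J u) zero_mem_paramSpace).tsum_le_tsum
    (fun i => ?_) (summable_paramDist hu zero_mem_paramSpace)
  refine mul_le_mul_of_nonneg_right ?_ (supNorm_nonneg _)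
  by_cases h : i < J <;> simp [truncParam, h]

theorem paramDist_truncParam_truncParam (J : ℕ) (u v : ℕ → ℝ) :
    paramDist Ω ψ (truncParam J u) (truncParam J v)
      = ∑ i ∈ Finset.range J, |u i - v i| * supNorm Ω (ψ i) := by
  rw [paramDist, tsum_eq_sum (s := Finset.range J) fun i hi => by
    simp [truncParam, if_neg (show ¬ i < J by simpa using hi)]]
  exact Finset.sum_congr rfl fun i hi => by
    simp [truncParam, if_pos (show i < J by simpa using hi)]

theorem tendsto_paramDist_truncParam {u : ℕ → ℝ} (hu : u ∈ paramSpace Ω ψ) :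
    Tendsto (fun J => paramDist Ω ψ u (truncParam J u)) atTop (𝓝 0) := by
  have hs : Summable fun i => |u i| * supNorm Ω (ψ i) := hu
  have h1 := tendsto_const_nhds (x := ∑' i, |u i| * supNorm Ω (ψ i)) |>.sub
    hs.hasSum.tendsto_sum_nat
  rw [sub_self] at h1
  refine h1.congr fun J => ?_
  have h2 : ∑ i ∈ Finset.range J, |u i| * supNorm Ω (ψ i)
      = ∑' i, |truncParam J u i| * supNorm Ω (ψ i) := by
    have := paramDist_truncParam_truncParam (Ω := Ω) (ψ := ψ) J u 0
    rw [paramDist] at this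
    simpa [truncParam] using this.symm
  rw [h2, ← hs.tsum_sub (truncParam_mem_paramSpace J u), paramDist]
  refine tsum_congr fun i => ?_
  by_cases h : i < J <;> simp [truncParam, h]

/-- Stability of the eikonal solution with respect to the parameter. -/
theorem IsEikonalSolution.le_exp_paramDist_mul (hΩ : IsLipschitzDomain Ω)
    {x₀ : EuclideanSpace ℝ (Fin d)} (hsStar : ∀ x ∈ closure Ω, 0 ≤ sStar x)
    (hψ : ∀ i, ∀ x ∈ closure Ω, |ψ i x| ≤ supNorm Ω (ψ i))
    (hcont : ∀ u ∈ paramSpace Ω ψ, ContinuousOn (slowness sStar sBar ψ u) (closure Ω))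
    {u v : ℕ → ℝ} (hu : u ∈ paramSpace Ω ψ) (hv : v ∈ paramSpace Ω ψ)
    {T₁ T₂ : EuclideanSpace ℝ (Fin d) → ℝ}
    (hT₁ : IsEikonalSolution Ω x₀ (slowness sStar sBar ψ u) T₁)
    (hT₂ : IsEikonalSolution Ω x₀ (slowness sStar sBar ψ v) T₂)
    {x : EuclideanSpace ℝ (Fin d)} (hx : x ∈ closure Ω) :
    T₁ x ≤ Real.exp (paramDist Ω ψ u v) * T₂ x :=
  hT₁.le_mul_of_le hΩ (hcont u hu) (hcont v hv) (fun z hz => slowness_pos (hsStar z hz) v) hT₂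
    (Real.exp_pos _)
    (fun z hz => slowness_le_exp_paramDist_mul (hsStar z hz) (fun i => hψ i z hz) hu hv) x hx

end Slowness

/-! ### Exponential moments of weighted series. -/

/-- Jensen's inequality for the exponential of a weighted sum of non-negative random variables,
without any independence. -/
theorem integrable_exp_tsum_and_integral_le {V : Type*} [MeasurableSpace V] {γ : Measure V}
    [IsProbabilityMeasure γ] {X : ℕ → V → ℝ} (hX : ∀ i, Measurable (X i))
    (hX0 : ∀ i v, 0 ≤ X i v) {w : ℕ → ℝ} (hw : ∀ i, 0 ≤ w i) {W : ℝ} (hW : 0 < W)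
    (hwW : ∀ n, ∑ i ∈ Finset.range n, w i ≤ W) (hsum : ∀ v, Summable fun i => X i v * w i)
    {m : ℝ} (hint : ∀ i, Integrable (fun v => Real.exp (W * X i v)) γ)
    (hm : ∀ i, ∫ v, Real.exp (W * X i v) ∂γ ≤ m) :
    Integrable (fun v => Real.exp (∑' i, X i v * w i)) γ ∧
      ∫ v, Real.exp (∑' i, X i v * w i) ∂γ ≤ m := by
  have hm1 : 1 ≤ m := by
    refine le_trans ?_ (hm 0)
    calc (1 : ℝ) = ∫ _, (1 : ℝ) ∂γ := by simp
      _ ≤ _ := integral_mono (integrable_const _) (hint 0) fun v =>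
        Real.one_le_exp (mul_nonneg hW.le (hX0 0 v))
  have hpart (n : ℕ) :
      ∫⁻ v, ENNReal.ofReal (Real.exp (∑ i ∈ Finset.range n, X i v * w i)) ∂γ
        ≤ ENNReal.ofReal m := by
    -- The weights `w i / W` may sum to less than one; the missing mass `q` is placed at the point
    -- `0`, where the exponential is `1 ≤ m`.
    set q : ℝ := 1 - ∑ i ∈ Finset.range n, w i / W with hq
    have hq0 : 0 ≤ q := by
      rw [hq, ← Finset.sum_div, sub_nonneg, div_le_one hW]
      exact hwW n
    have hpt (v : V) : Real.exp (∑ i ∈ Finset.range n, X i v * w i)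
        ≤ q + ∑ i ∈ Finset.range n, w i / W * Real.exp (W * X i v) := by
      have h := convexOn_exp.map_add_sum_le (t := Finset.range n) (w := fun i => w i / W)
        (p := fun i => W * X i v) (v := q) (q := 0) (fun i _ => div_nonneg (hw i) hW.le)
        (by rw [hq]; ring) (fun _ _ => Set.mem_univ _) hq0 (Set.mem_univ _)
      simp only [smul_eq_mul, mul_zero, zero_add, Real.exp_zero, mul_one] at h
      refine le_trans (le_of_eq ?_) h
      congr 1
      refine Finset.sum_congr rfl fun i _ => ?_
      field_simp
    have hsi : Integrable (fun v => ∑ i ∈ Finset.range n, w i / W * Real.exp (W * X i v)) γ :=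
      integrable_finsetSum _ fun i _ => (hint i).const_mul _
    have hGi : Integrable
        (fun v => q + ∑ i ∈ Finset.range n, w i / W * Real.exp (W * X i v)) γ :=
      (integrable_const q).add hsi
    refine (lintegral_mono fun v => ENNReal.ofReal_le_ofReal (hpt v)).trans ?_
    rw [← ofReal_integral_eq_lintegral_ofReal hGi
      (Eventually.of_forall fun v => (Real.exp_pos _).le.trans (hpt v))]
    refine ENNReal.ofReal_le_ofReal ?_
    rw [integral_add (integrable_const q) hsi,
      integral_finsetSum _ fun i _ => (hint i).const_mul _]
    simp only [integral_const, integral_const_mul, probReal_univ, one_smul]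
    calc q + ∑ i ∈ Finset.range n, w i / W * ∫ v, Real.exp (W * X i v) ∂γ
        ≤ q * m + ∑ i ∈ Finset.range n, w i / W * m := by
          refine add_le_add (le_mul_of_one_le_right hq0 hm1) (Finset.sum_le_sum fun i _ => ?_)
          exact mul_le_mul_of_nonneg_left (hm i) (div_nonneg (hw i) hW.le)
      _ = m := by rw [← Finset.sum_mul, hq]; ring
  have hlim (v : V) : Tendsto
      (fun n => ENNReal.ofReal (Real.exp (∑ i ∈ Finset.range n, X i v * w i))) atTop
      (𝓝 (ENNReal.ofReal (Real.exp (∑' i, X i v * w i)))) :=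
    (ENNReal.continuous_ofReal.comp Real.continuous_exp).continuousAt.tendsto.comp
      (hsum v).hasSum.tendsto_sum_nat
  have hpm (n : ℕ) : Measurable
      fun v => ENNReal.ofReal (Real.exp (∑ i ∈ Finset.range n, X i v * w i)) :=
    (Real.measurable_exp.comp
      (Finset.measurable_sum _ fun i _ => (hX i).mul_const _)).ennreal_ofReal
  -- Fatou's lemma carries the bound from the partial sums to the series.
  have hle : ∫⁻ v, ENNReal.ofReal (Real.exp (∑' i, X i v * w i)) ∂γ ≤ ENNReal.ofReal m := by
    calc _ = ∫⁻ v, liminf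
          (fun n => ENNReal.ofReal (Real.exp (∑ i ∈ Finset.range n, X i v * w i))) atTop ∂γ :=
        lintegral_congr fun v => (hlim v).liminf_eq.symm
      _ ≤ liminf (fun n => ∫⁻ v,
          ENNReal.ofReal (Real.exp (∑ i ∈ Finset.range n, X i v * w i)) ∂γ) atTop :=
        lintegral_liminf_le hpm
      _ ≤ ENNReal.ofReal m := liminf_le_of_frequently_le' (Frequently.of_forall hpart)
  have hmeas : Measurable fun v => Real.exp (∑' i, X i v * w i) :=
    measurable_of_tendsto_metrizable
      (fun n => Real.measurable_exp.comp (Finset.measurable_sum (Finset.range n)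
        fun i _ => (hX i).mul_const (w i)))
      (tendsto_pi_nhds.2 fun v =>
        Real.continuous_exp.continuousAt.tendsto.comp (hsum v).hasSum.tendsto_sum_nat)
  have hI : Integrable (fun v => Real.exp (∑' i, X i v * w i)) γ := by
    refine ⟨hmeas.aestronglyMeasurable, ?_⟩
    rw [hasFiniteIntegral_iff_ofReal (Eventually.of_forall fun v => (Real.exp_pos _).le)]
    exact hle.trans_lt ENNReal.ofReal_lt_top
  refine ⟨hI, ?_⟩
  rw [← ofReal_integral_eq_lintegral_ofReal hI
    (Eventually.of_forall fun v => (Real.exp_pos _).le)] at hle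
  exact (ENNReal.ofReal_le_ofReal_iff (by linarith)).1 hle

/-! ### The Gaussian prior on the parameter space. -/

section Prior

variable {d : ℕ} {Ω : Set (EuclideanSpace ℝ (Fin d))} {ψ : ℕ → EuclideanSpace ℝ (Fin d) → ℝ}

theorem mem_paramSpace_iff (u : ℕ → ℝ) :
    u ∈ paramSpace Ω ψ ↔ ∑' i, ENNReal.ofReal (|u i| * supNorm Ω (ψ i)) ≠ ⊤ := by
  refine ⟨fun h => h.tsum_ofReal_ne_top, fun h => ?_⟩
  refine (ENNReal.summable_toReal h).congr fun i => ?_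
  exact ENNReal.toReal_ofReal (mul_nonneg (abs_nonneg _) (supNorm_nonneg _))

theorem measurable_tsum_abs_mul :
    Measurable fun u : ℕ → ℝ => ∑' i, ENNReal.ofReal (|u i| * supNorm Ω (ψ i)) := by
  exact Measurable.tsum fun i => by fun_prop

theorem measurableSet_paramSpace : MeasurableSet (paramSpace Ω ψ) := by
  have : paramSpace Ω ψ =
      (fun u : ℕ → ℝ => ∑' i, ENNReal.ofReal (|u i| * supNorm Ω (ψ i))) ⁻¹' {⊤}ᶜ := by
    ext u; exact mem_paramSpace_iff u
  rw [this]
  exact measurable_tsum_abs_mul (measurableSet_singleton _).compl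

/-- By Tonelli, `∑ |u_i| b_i` has mean `E|ξ| * ∑ b_i`, which is finite, so the series converges
almost surely. -/
theorem ae_mem_paramSpace (hb : Summable fun i => supNorm Ω (ψ i)) :
    ∀ᵐ u ∂Measure.infinitePi fun _ : ℕ => gaussianReal 0 1, u ∈ paramSpace Ω ψ := by
  have hg : ∫⁻ x, ENNReal.ofReal |x| ∂gaussianReal 0 1 ≠ ⊤ := by
    have h1 : Integrable (fun x : ℝ => x) (gaussianReal 0 1) :=
      (memLp_id_gaussianReal 1).integrable (by norm_num)
    have h2 := h1.hasFiniteIntegral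
    rw [hasFiniteIntegral_iff_norm] at h2
    exact h2.ne
  have hterm (i : ℕ) : ∫⁻ u, ENNReal.ofReal (|u i| * supNorm Ω (ψ i))
      ∂Measure.infinitePi (fun _ : ℕ => gaussianReal 0 1)
      = (∫⁻ x, ENNReal.ofReal |x| ∂gaussianReal 0 1) * ENNReal.ofReal (supNorm Ω (ψ i)) := by
    have h := (measurePreserving_eval_infinitePi (fun _ : ℕ => gaussianReal 0 1) i).lintegral_comp
      (f := fun x : ℝ => ENNReal.ofReal (|x| * supNorm Ω (ψ i))) (by fun_prop)
    simp only [Function.eval] at h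
    rw [h]
    simp_rw [ENNReal.ofReal_mul (abs_nonneg _)]
    rw [lintegral_mul_const _ (by fun_prop)]
  have htot : ∫⁻ u, ∑' i, ENNReal.ofReal (|u i| * supNorm Ω (ψ i))
      ∂Measure.infinitePi (fun _ : ℕ => gaussianReal 0 1) ≠ ⊤ := by
    rw [lintegral_tsum fun i =>
      (((measurable_pi_apply i).abs).mul_const _).ennreal_ofReal.aemeasurable]
    simp_rw [hterm]
    rw [ENNReal.tsum_mul_left]
    exact ENNReal.mul_ne_top hg hb.tsum_ofReal_ne_top
  filter_upwards [ae_lt_top measurable_tsum_abs_mul htot] with u hu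
  exact (mem_paramSpace_iff u).2 hu.ne

theorem map_val_prior (hb : Summable fun i => supNorm Ω (ψ i)) :
    (prior Ω ψ).map Subtype.val = Measure.infinitePi fun _ : ℕ => gaussianReal 0 1 := by
  rw [prior, (MeasurableEmbedding.subtype_coe measurableSet_paramSpace).map_comap,
    Subtype.range_coe]
  exact Measure.restrict_eq_self_of_ae_mem (ae_mem_paramSpace hb)

theorem isProbabilityMeasure_prior (hb : Summable fun i => supNorm Ω (ψ i)) :
    IsProbabilityMeasure (prior Ω ψ) := by
  constructor
  have h := congrArg (fun μ => μ Set.univ) (map_val_prior hb)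
  simpa [Measure.map_apply measurable_subtype_coe MeasurableSet.univ] using h

theorem measurePreserving_coord_prior (hb : Summable fun i => supNorm Ω (ψ i)) (i : ℕ) :
    MeasurePreserving (fun u : paramSpace Ω ψ => (u : ℕ → ℝ) i) (prior Ω ψ)
      (gaussianReal 0 1) :=
  (measurePreserving_eval_infinitePi (fun _ : ℕ => gaussianReal 0 1) i).comp
    ⟨measurable_subtype_coe, map_val_prior hb⟩

theorem integrable_exp_mul_abs_gaussianReal (W : ℝ) :
    Integrable (fun x : ℝ => Real.exp (W * |x|)) (gaussianReal 0 1) :=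
  integrable_exp_mul_abs (X := fun x : ℝ => x) (integrable_exp_mul_gaussianReal W)
    (integrable_exp_mul_gaussianReal (-W))

theorem integrable_exp_tsum_prior (hb : Summable fun i => supNorm Ω (ψ i)) {w : ℕ → ℝ}
    (hw : ∀ i, 0 ≤ w i) {W : ℝ} (hW : 0 < W) (hwW : ∀ n, ∑ i ∈ Finset.range n, w i ≤ W)
    (hsum : ∀ u : paramSpace Ω ψ, Summable fun i => |(u : ℕ → ℝ) i| * w i) :
    Integrable (fun u : paramSpace Ω ψ => Real.exp (∑' i, |(u : ℕ → ℝ) i| * w i)) (prior Ω ψ) ∧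
      ∫ u : paramSpace Ω ψ, Real.exp (∑' i, |(u : ℕ → ℝ) i| * w i) ∂prior Ω ψ
        ≤ ∫ x, Real.exp (W * |x|) ∂gaussianReal 0 1 := by
  have := isProbabilityMeasure_prior hb
  have hmp := measurePreserving_coord_prior hb
  refine integrable_exp_tsum_and_integral_le
    (X := fun i (u : paramSpace Ω ψ) => |(u : ℕ → ℝ) i|)
    (fun i => (hmp i).measurable.abs) (fun i u => abs_nonneg _) hw hW hwW hsum
    (fun i => ?_) (fun i => ?_)
  · exact (hmp i).integrable_comp_of_integrable (integrable_exp_mul_abs_gaussianReal W)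
  · have h := integral_map (μ := prior Ω ψ) (hmp i).measurable.aemeasurable
      (f := fun x : ℝ => Real.exp (W * |x|)) (by fun_prop)
    rw [(hmp i).map_eq] at h
    exact h.ge

end Prior

/-! ### Tail sums of the decaying norms. -/

/-- The sum is compared with the integral of `x ^ (-p)` from `J` to `n`. The shift `i + 1` selects
right endpoints, so the bound is a clean power of `J`. -/
theorem sum_Ico_rpow_neg_le {p : ℝ} (hp : 1 < p) {J : ℕ} (hJ : 1 ≤ J) (n : ℕ) :
    ∑ i ∈ Finset.Ico J n, ((i : ℝ) + 1) ^ (-p) ≤ (J : ℝ) ^ (-(p - 1)) / (p - 1) := by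
  have hJ0 : (0 : ℝ) < J := by exact_mod_cast hJ
  have hp1 : 0 < p - 1 := by linarith
  rcases le_total n J with h | h
  · rw [Finset.Ico_eq_empty_of_le h, Finset.sum_empty]
    positivity
  have hn0 : (0 : ℝ) < n := by exact_mod_cast hJ.trans h
  have h1 := AntitoneOn.sum_le_integral_Ico (f := fun x : ℝ => x ^ (-p)) h
    fun x hx y _ hxy => Real.rpow_le_rpow_of_nonpos (hJ0.trans_le hx.1) hxy (by linarith)
  rw [integral_rpow (Or.inr ⟨by linarith, by
    rw [Set.uIcc_of_le (by exact_mod_cast h)]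
    exact fun h0 => absurd h0.1 (not_le.2 hJ0)⟩)] at h1
  push_cast at h1
  refine h1.trans ?_
  have h2 : -p + 1 = -(p - 1) := by ring
  rw [h2, div_neg, ← neg_div, neg_sub]
  gcongr
  linarith [Real.rpow_nonneg hn0.le (-(p - 1))]

theorem sum_range_tail_le {p c : ℝ} (hp : 1 < p) (hc : 0 < c) {b : ℕ → ℝ}
    (hb : ∀ i : ℕ, b i ≤ c * ((i : ℝ) + 1) ^ (-p)) {J : ℕ} (hJ : 1 ≤ J) (n : ℕ) :
    ∑ i ∈ Finset.range n, (if i < J then 0 else b i)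
      ≤ c / (p - 1) * (J : ℝ) ^ (-(p - 1)) := by
  calc ∑ i ∈ Finset.range n, (if i < J then 0 else b i)
      = ∑ i ∈ Finset.Ico J n, b i := by
        rw [Finset.sum_ite, Finset.sum_const_zero, zero_add]
        refine Finset.sum_congr ?_ fun _ _ => rfl
        ext i
        simp [and_comm]
    _ ≤ ∑ i ∈ Finset.Ico J n, c * ((i : ℝ) + 1) ^ (-p) := Finset.sum_le_sum fun i _ => hb i
    _ ≤ c * ((J : ℝ) ^ (-(p - 1)) / (p - 1)) := by
        rw [← Finset.mul_sum]
        exact mul_le_mul_of_nonneg_left (sum_Ico_rpow_neg_le hp hJ n) hc.le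
    _ = _ := by ring

/-! ### Hellinger stability of posteriors. -/

section Hellinger

variable {V : Type*} [MeasurableSpace V] {γ : Measure V} {Φ Φ' : V → ℝ}

theorem integrable_exp_neg [IsFiniteMeasure γ] (hΦ : AEStronglyMeasurable Φ γ)
    (h0 : ∀ u, 0 ≤ Φ u) : Integrable (fun u => Real.exp (-Φ u)) γ := by
  refine (integrable_const (1 : ℝ)).mono'
    (Real.continuous_exp.comp_aestronglyMeasurable hΦ.neg) (Eventually.of_forall fun u => ?_)
  rw [Real.norm_eq_abs, Real.abs_exp, Real.exp_le_one_iff]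
  linarith [h0 u]

theorem isProbabilityMeasure_posterior [IsProbabilityMeasure γ] (hΦ : Measurable Φ)
    (h0 : ∀ u, 0 ≤ Φ u) : IsProbabilityMeasure (posterior γ Φ) :=
  isProbabilityMeasure_tilted (integrable_exp_neg hΦ.aestronglyMeasurable h0)

/-- The function `exp (-x / 2)` is `1 / 2`-Lipschitz on the nonnegative half-line. -/
theorem exp_neg_half_sub_sq_le {x y : ℝ} (hx : 0 ≤ x) (hy : 0 ≤ y) :
    (Real.exp (-x / 2) - Real.exp (-y / 2)) ^ 2 ≤ 1 / 4 * (x - y) ^ 2 := by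
  wlog hxy : x ≤ y generalizing x y
  · have := this hy hx (le_of_not_ge hxy)
    nlinarith
  have h1 : Real.exp (-y / 2) ≤ Real.exp (-x / 2) := Real.exp_le_exp.2 (by linarith)
  have h2 : Real.exp (-x / 2) ≤ 1 := Real.exp_le_one_iff.2 (by linarith)
  have h3 : Real.exp (-y / 2) = Real.exp (-x / 2) * Real.exp (-(y - x) / 2) := by
    rw [← Real.exp_add]; congr 1; ring
  have h4 := Real.add_one_le_exp (-(y - x) / 2)
  have h5 : Real.exp (-x / 2) - Real.exp (-y / 2) ≤ (y - x) / 2 := by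
    rw [h3]
    nlinarith [Real.exp_pos (-x / 2)]
  nlinarith

theorem sqrt_rnDeriv_posterior [IsProbabilityMeasure γ] (hΦ : Measurable Φ) :
    (fun u => √((posterior γ Φ).rnDeriv γ u).toReal) =ᵐ[γ]
      fun u => Real.exp (-Φ u / 2) / √(∫ u, Real.exp (-Φ u) ∂γ) := by
  filter_upwards [rnDeriv_tilted_left_self (μ := γ) (f := fun u => -Φ u) hΦ.neg.aemeasurable]
    with u hu
  have hZ : 0 ≤ ∫ u, Real.exp (-Φ u) ∂γ := integral_nonneg fun u => (Real.exp_pos _).le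
  rw [posterior, hu, ENNReal.toReal_ofReal (div_nonneg (Real.exp_pos _).le hZ),
    Real.sqrt_div (Real.exp_pos _).le, Real.exp_half]

/-- Local Lipschitz dependence of the posterior on the potential in the Hellinger distance. -/
theorem hellingerDist_posterior_le [IsProbabilityMeasure γ] (hΦ : Measurable Φ)
    (hΦ' : Measurable Φ') (h0 : ∀ u, 0 ≤ Φ u) (h0' : ∀ u, 0 ≤ Φ' u) {z M : ℝ} (hz : 0 < z)
    (hZ : z ≤ ∫ u, Real.exp (-Φ u) ∂γ) (hZ' : z ≤ ∫ u, Real.exp (-Φ' u) ∂γ)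
    (hint : Integrable (fun u => (Φ u - Φ' u) ^ 2) γ) (hM : ∫ u, (Φ u - Φ' u) ^ 2 ∂γ ≤ M) :
    hellingerDist γ (posterior γ Φ) (posterior γ Φ') ≤ √(1 / (8 * z) * M) := by
  set Z := ∫ u, Real.exp (-Φ u) ∂γ with hZdef
  set Z' := ∫ u, Real.exp (-Φ' u) ∂γ with hZdef'
  set a := √Z with ha
  set b := √Z' with hb
  have hapos : 0 < a := Real.sqrt_pos.2 (hz.trans_le hZ)
  have hbpos : 0 < b := Real.sqrt_pos.2 (hz.trans_le hZ')
  have ha2 : a ^ 2 = Z := Real.sq_sqrt (hz.le.trans hZ)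
  have hb2 : b ^ 2 = Z' := Real.sq_sqrt (hz.le.trans hZ')
  have hab : z ≤ a * b := by
    calc z = √z * √z := (Real.mul_self_sqrt hz.le).symm
      _ ≤ a * b := mul_le_mul (Real.sqrt_le_sqrt hZ) (Real.sqrt_le_sqrt hZ')
        (Real.sqrt_nonneg _) (Real.sqrt_nonneg _)
  have hf2 (u : V) : Real.exp (-Φ u / 2) ^ 2 = Real.exp (-Φ u) := by
    rw [← Real.exp_nat_mul]; congr 1; push_cast; ring
  have hg2 (u : V) : Real.exp (-Φ' u / 2) ^ 2 = Real.exp (-Φ' u) := by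
    rw [← Real.exp_nat_mul]; congr 1; push_cast; ring
  have hi := integrable_exp_neg (γ := γ) hΦ.aestronglyMeasurable h0
  have hi' := integrable_exp_neg (γ := γ) hΦ'.aestronglyMeasurable h0'
  have hle (u : V) : (Real.exp (-Φ u / 2) - Real.exp (-Φ' u / 2)) ^ 2
      ≤ 1 / 4 * (Φ u - Φ' u) ^ 2 := exp_neg_half_sub_sq_le (h0 u) (h0' u)
  have hid : Integrable (fun u => (Real.exp (-Φ u / 2) - Real.exp (-Φ' u / 2)) ^ 2) γ := by
    refine (hint.const_mul (1 / 4)).mono' (by fun_prop) (Eventually.of_forall fun u => ?_)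
    rw [Real.norm_of_nonneg (sq_nonneg _)]
    exact hle u
  have hI : ∫ u, (Real.exp (-Φ u / 2) - Real.exp (-Φ' u / 2)) ^ 2 ∂γ ≤ 1 / 4 * M := by
    refine (integral_mono hid (hint.const_mul (1 / 4)) hle).trans ?_
    rw [integral_const_mul]
    linarith
  set I := ∫ u, (Real.exp (-Φ u / 2) - Real.exp (-Φ' u / 2)) ^ 2 ∂γ with hIdef
  have hcalc : ∫ u, (√((posterior γ Φ).rnDeriv γ u).toReal
      - √((posterior γ Φ').rnDeriv γ u).toReal) ^ 2 ∂γ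
      = (a ^ 2)⁻¹ * Z + (b ^ 2)⁻¹ * Z' - (a * b)⁻¹ * (Z + Z' - I) := by
    have h1 : (fun u => (√((posterior γ Φ).rnDeriv γ u).toReal
        - √((posterior γ Φ').rnDeriv γ u).toReal) ^ 2) =ᵐ[γ] fun u =>
        (a ^ 2)⁻¹ * Real.exp (-Φ u) + (b ^ 2)⁻¹ * Real.exp (-Φ' u)
          - (a * b)⁻¹ * (Real.exp (-Φ u) + Real.exp (-Φ' u)
            - (Real.exp (-Φ u / 2) - Real.exp (-Φ' u / 2)) ^ 2) := by
      filter_upwards [sqrt_rnDeriv_posterior (γ := γ) hΦ, sqrt_rnDeriv_posterior (γ := γ) hΦ']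
        with u hu hu'
      rw [hu, hu', ← hf2, ← hg2]
      simp only [← hZdef, ← hZdef', ← ha, ← hb]
      field_simp
      ring
    rw [integral_congr_ae h1, integral_sub, integral_add, integral_const_mul, integral_const_mul,
      integral_const_mul, integral_sub, integral_add hi hi']
    · exact hi.add hi'
    · exact hid
    · exact hi.const_mul _
    · exact hi'.const_mul _
    · exact (hi.const_mul _).add (hi'.const_mul _)
    · exact ((hi.add hi').sub hid).const_mul _
  rw [hellingerDist, hcalc, ← ha2, ← hb2]
  refine Real.sqrt_le_sqrt ?_
  have hI0 : 0 ≤ I := integral_nonneg fun u => sq_nonneg _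
  -- Since `a ^ 2` and `b ^ 2` are the normalising constants, their discrepancy enters as `-(a - b)
  -- ^ 2` and can be dropped; no estimate of `Z - Z'` is needed.
  have h2 : (a ^ 2)⁻¹ * a ^ 2 + (b ^ 2)⁻¹ * b ^ 2 - (a * b)⁻¹ * (a ^ 2 + b ^ 2 - I)
      = (I - (a - b) ^ 2) / (a * b) := by
    field_simp
    ring
  rw [h2]
  calc 1 / 2 * ((I - (a - b) ^ 2) / (a * b)) ≤ 1 / 2 * (I / (a * b)) := by
        gcongr
        linarith [sq_nonneg (a - b)]
    _ ≤ 1 / 2 * (I / z) := by gcongr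
    _ ≤ 1 / 2 * (1 / 4 * M / z) := by gcongr
    _ = 1 / (8 * z) * M := by ring

end Hellinger

/-! ### Bounds for the quadratic misfit. -/

section Potential

variable {N : ℕ}

/-- The sum of the absolute values of the entries of the precision matrix. -/
def precisionSum (cov : Matrix (Fin N) (Fin N) ℝ) : ℝ := ∑ i, ∑ j, |cov⁻¹ i j|

theorem precisionSum_nonneg (cov : Matrix (Fin N) (Fin N) ℝ) : 0 ≤ precisionSum cov :=
  Finset.sum_nonneg fun _ _ => Finset.sum_nonneg fun _ _ => abs_nonneg _

theorem abs_dotProduct_mulVec_le (cov : Matrix (Fin N) (Fin N) ℝ) {v w : Fin N → ℝ} {a b : ℝ}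
    (hv : ∀ k, |v k| ≤ a) (hw : ∀ k, |w k| ≤ b) :
    |v ⬝ᵥ (cov⁻¹.mulVec w)| ≤ precisionSum cov * (a * b) := by
  simp only [dotProduct, Matrix.mulVec, precisionSum, Finset.mul_sum, Finset.sum_mul]
  refine (Finset.abs_sum_le_sum_abs _ _).trans (Finset.sum_le_sum fun i _ => ?_)
  refine (Finset.abs_sum_le_sum_abs _ _).trans (Finset.sum_le_sum fun j _ => ?_)
  rw [abs_mul, abs_mul, mul_left_comm]
  have := (abs_nonneg (v i)).trans (hv i)
  exact mul_le_mul_of_nonneg_left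
    (mul_le_mul (hv i) (hw j) (abs_nonneg _) this) (abs_nonneg _)

theorem abs_covNormSq_sub_le (cov : Matrix (Fin N) (Fin N) ℝ) {v w : EuclideanSpace ℝ (Fin N)}
    {a D : ℝ} (hv : ∀ k, |v k| ≤ a) (hw : ∀ k, |w k| ≤ a) (hvw : ∀ k, |v k - w k| ≤ D) :
    |covNormSq cov v - covNormSq cov w| ≤ 2 * (precisionSum cov * (a * D)) := by
  have h1 : covNormSq cov v - covNormSq cov w
      = (v - w).ofLp ⬝ᵥ (cov⁻¹.mulVec v.ofLp) + w.ofLp ⬝ᵥ (cov⁻¹.mulVec (v - w).ofLp) := by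
    simp only [covNormSq, WithLp.ofLp_sub, Matrix.mulVec_sub, sub_dotProduct, dotProduct_sub]
    ring
  rw [h1]
  refine (abs_add_le _ _).trans ?_
  have h2 := abs_dotProduct_mulVec_le cov (v := (v - w).ofLp) hvw hv
  have h3 := abs_dotProduct_mulVec_le cov (w := (v - w).ofLp) hw hvw
  linarith [mul_comm a D ▸ h2]

theorem covNormSq_nonneg {cov : Matrix (Fin N) (Fin N) ℝ} (hcov : cov.PosDef)
    (v : EuclideanSpace ℝ (Fin N)) : 0 ≤ covNormSq cov v := by
  simpa [covNormSq] using hcov.inv.posSemidef.dotProduct_mulVec_nonneg v.ofLp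

theorem potential_nonneg {V : Type*} {cov : Matrix (Fin N) (Fin N) ℝ} (hcov : cov.PosDef)
    (G : V → EuclideanSpace ℝ (Fin N)) (δ : EuclideanSpace ℝ (Fin N)) (u : V) :
    0 ≤ potential cov G δ u :=
  mul_nonneg (by norm_num) (covNormSq_nonneg hcov _)

theorem measurable_potential {V : Type*} [MeasurableSpace V] (cov : Matrix (Fin N) (Fin N) ℝ)
    {G : V → EuclideanSpace ℝ (Fin N)} (hG : ∀ k, Measurable fun u => G u k)
    (δ : EuclideanSpace ℝ (Fin N)) : Measurable (potential cov G δ) := by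
  have h : Measurable fun u => ∑ i, (δ i - G u i) * ∑ j, cov⁻¹ i j * (δ j - G u j) :=
    Finset.measurable_sum _ fun i _ => ((hG i).const_sub _).mul
      (Finset.measurable_sum _ fun j _ => ((hG j).const_sub _).const_mul _)
  exact h.const_mul (1 / 2)

theorem potential_le {V : Type*} (cov : Matrix (Fin N) (Fin N) ℝ)
    {G : V → EuclideanSpace ℝ (Fin N)} {δ : EuclideanSpace ℝ (Fin N)} {u : V} {a : ℝ}
    (h : ∀ k, |δ k - G u k| ≤ a) :
    potential cov G δ u ≤ 1 / 2 * (precisionSum cov * (a * a)) :=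
  mul_le_mul_of_nonneg_left ((le_abs_self _).trans
    (abs_dotProduct_mulVec_le cov (v := (δ - G u).ofLp) (w := (δ - G u).ofLp) h h)) (by norm_num)

theorem abs_potential_sub_le {V : Type*} (cov : Matrix (Fin N) (Fin N) ℝ)
    {G G' : V → EuclideanSpace ℝ (Fin N)} {δ : EuclideanSpace ℝ (Fin N)} {u : V} {a D : ℝ}
    (h : ∀ k, |δ k - G u k| ≤ a) (h' : ∀ k, |δ k - G' u k| ≤ a)
    (hD : ∀ k, |G u k - G' u k| ≤ D) :
    |potential cov G δ u - potential cov G' δ u| ≤ precisionSum cov * (a * D) := by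
  have h1 := abs_covNormSq_sub_le cov (v := δ - G u) (w := δ - G' u) (D := D) h h' fun k => by
    have h2 : (δ - G u) k - (δ - G' u) k = -(G u k - G' u k) := by
      simp only [PiLp.sub_apply]; ring
    rw [h2, abs_neg]
    exact hD k
  rw [potential, potential, ← mul_sub, abs_mul, abs_of_pos (by norm_num : (0 : ℝ) < 1 / 2)]
  linarith

end Potential

/-! ### Growth, stability and measurability of travel times. -/

section ForwardMap

variable {d : ℕ} {Ω : Set (EuclideanSpace ℝ (Fin d))} {x₀ : EuclideanSpace ℝ (Fin d)}
  {sStar sBar : EuclideanSpace ℝ (Fin d) → ℝ} {ψ : ℕ → EuclideanSpace ℝ (Fin d) → ℝ}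

/-- Comparison is used in both directions, which avoids having to know the signs of `T` and `T₀`. -/
theorem IsEikonalSolution.abs_le_mul_exp (hΩ : IsLipschitzDomain Ω)
    (hsStar : ∀ x ∈ closure Ω, 0 ≤ sStar x)
    (hψ : ∀ i, ∀ x ∈ closure Ω, |ψ i x| ≤ supNorm Ω (ψ i))
    (hcont : ∀ u ∈ paramSpace Ω ψ, ContinuousOn (slowness sStar sBar ψ u) (closure Ω))
    {u : ℕ → ℝ} (hu : u ∈ paramSpace Ω ψ) {T T₀ : EuclideanSpace ℝ (Fin d) → ℝ}
    (hT : IsEikonalSolution Ω x₀ (slowness sStar sBar ψ u) T)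
    (hT₀ : IsEikonalSolution Ω x₀ (slowness sStar sBar ψ 0) T₀)
    {x : EuclideanSpace ℝ (Fin d)} (hx : x ∈ closure Ω) :
    |T x| ≤ |T₀ x| * Real.exp (paramDist Ω ψ u 0) := by
  have h1 := hT.le_exp_paramDist_mul hΩ hsStar hψ hcont hu zero_mem_paramSpace hT₀ hx
  have h2 := hT₀.le_exp_paramDist_mul hΩ hsStar hψ hcont zero_mem_paramSpace hu hT hx
  rw [paramDist_comm] at h2
  have h3 := Real.one_le_exp (paramDist_nonneg (Ω := Ω) (ψ := ψ) u 0)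
  set E := Real.exp (paramDist Ω ψ u 0)
  have h4 := abs_nonneg (T₀ x)
  refine abs_le.2 ⟨?_, ?_⟩
  · by_contra! h5
    nlinarith [neg_abs_le (T₀ x), mul_le_mul_of_nonneg_left h3 h4]
  · nlinarith [le_abs_self (T₀ x)]

theorem exp_sub_one_le_mul_exp (x : ℝ) : Real.exp x - 1 ≤ x * Real.exp x := by
  have h1 := mul_le_mul_of_nonneg_right (Real.add_one_le_exp (-x)) (Real.exp_pos x).le
  rw [← Real.exp_add, neg_add_cancel, Real.exp_zero] at h1
  linarith

theorem IsEikonalSolution.sub_le_mul_paramDist (hΩ : IsLipschitzDomain Ω)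
    (hsStar : ∀ x ∈ closure Ω, 0 ≤ sStar x)
    (hψ : ∀ i, ∀ x ∈ closure Ω, |ψ i x| ≤ supNorm Ω (ψ i))
    (hcont : ∀ u ∈ paramSpace Ω ψ, ContinuousOn (slowness sStar sBar ψ u) (closure Ω))
    {u v : ℕ → ℝ} (hu : u ∈ paramSpace Ω ψ) (hv : v ∈ paramSpace Ω ψ)
    {T₁ T₂ : EuclideanSpace ℝ (Fin d) → ℝ}
    (hT₁ : IsEikonalSolution Ω x₀ (slowness sStar sBar ψ u) T₁)
    (hT₂ : IsEikonalSolution Ω x₀ (slowness sStar sBar ψ v) T₂)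
    {x : EuclideanSpace ℝ (Fin d)} (hx : x ∈ closure Ω) {B : ℝ} (hB : |T₂ x| ≤ B) :
    T₁ x - T₂ x ≤ B * (paramDist Ω ψ u v * Real.exp (paramDist Ω ψ u v)) := by
  have h1 := hT₁.le_exp_paramDist_mul hΩ hsStar hψ hcont hu hv hT₂ hx
  have h3 := Real.one_le_exp (paramDist_nonneg (Ω := Ω) (ψ := ψ) u v)
  have h4 := exp_sub_one_le_mul_exp (paramDist Ω ψ u v)
  have hB0 : 0 ≤ B := (abs_nonneg _).trans hB
  calc T₁ x - T₂ x ≤ (Real.exp (paramDist Ω ψ u v) - 1) * T₂ x := by linarith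
    _ ≤ (Real.exp (paramDist Ω ψ u v) - 1) * B :=
      mul_le_mul_of_nonneg_left ((le_abs_self _).trans hB) (by linarith)
    _ ≤ B * (paramDist Ω ψ u v * Real.exp (paramDist Ω ψ u v)) := by
      rw [mul_comm]
      exact mul_le_mul_of_nonneg_left h4 hB0

theorem tendsto_of_exp_mul_bounds {ι : Type*} {l : Filter ι} {f D : ι → ℝ} {a : ℝ}
    (hD : Tendsto D l (𝓝 0)) (h1 : ∀ i, f i ≤ Real.exp (D i) * a)
    (h2 : ∀ i, a ≤ Real.exp (D i) * f i) : Tendsto f l (𝓝 a) := by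
  have hu : Tendsto (fun i => Real.exp (D i) * a) l (𝓝 a) := by
    simpa using ((Real.continuous_exp.tendsto 0).comp hD).mul_const a
  have hl : Tendsto (fun i => Real.exp (-D i) * a) l (𝓝 a) := by
    simpa using ((Real.continuous_exp.tendsto 0).comp (by simpa using hD.neg)).mul_const a
  refine tendsto_of_tendsto_of_tendsto_of_le_of_le hl hu (fun i => ?_) h1
  have h3 := mul_le_mul_of_nonneg_left (h2 i) (Real.exp_pos (-D i)).le
  rwa [← mul_assoc, ← Real.exp_add, neg_add_cancel, Real.exp_zero, one_mul] at h3

/-- Only finitely many coordinates matter, so the distance of truncated parameters is continuous in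
the product topology. -/
theorem continuous_truncated_solution (hΩ : IsLipschitzDomain Ω)
    (hsStar : ∀ x ∈ closure Ω, 0 ≤ sStar x)
    (hψ : ∀ i, ∀ x ∈ closure Ω, |ψ i x| ≤ supNorm Ω (ψ i))
    (hcont : ∀ u ∈ paramSpace Ω ψ, ContinuousOn (slowness sStar sBar ψ u) (closure Ω))
    {J : ℕ} {T : paramSpace Ω ψ → EuclideanSpace ℝ (Fin d) → ℝ}
    (hT : ∀ u : paramSpace Ω ψ, IsEikonalSolution Ω x₀
      (slowness sStar sBar ψ (truncParam J (u : ℕ → ℝ))) (T u))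
    {x : EuclideanSpace ℝ (Fin d)} (hx : x ∈ closure Ω) : Continuous fun u => T u x := by
  rw [continuous_iff_continuousAt]
  intro v
  have hle (u w : paramSpace Ω ψ) := (hT u).le_exp_paramDist_mul hΩ hsStar hψ hcont
    (truncParam_mem_paramSpace J _) (truncParam_mem_paramSpace J _) (hT w) hx
  refine tendsto_of_exp_mul_bounds
    (D := fun u : paramSpace Ω ψ => paramDist Ω ψ (truncParam J (u : ℕ → ℝ))
      (truncParam J (v : ℕ → ℝ))) ?_ (fun u => hle u v) fun u => by rw [paramDist_comm]; exact hle v u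
  simp only [paramDist_truncParam_truncParam]
  have hc : Continuous fun u : paramSpace Ω ψ =>
      ∑ i ∈ Finset.range J, |(u : ℕ → ℝ) i - (v : ℕ → ℝ) i| * supNorm Ω (ψ i) := by
    refine continuous_finsetSum _ fun i _ => ?_
    have : Continuous fun u : paramSpace Ω ψ => (u : ℕ → ℝ) i :=
      (continuous_apply i).comp continuous_subtype_val
    exact (this.sub continuous_const).abs.mul continuous_const
  simpa using hc.tendsto v

/-- The weighted `ℓ¹` distance is not controlled by the product topology. The solution is instead a
pointwise limit of its values at truncated parameters, which are continuous in `u`. -/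
theorem measurable_solution (hΩ : IsLipschitzDomain Ω)
    (hsStar : ∀ x ∈ closure Ω, 0 ≤ sStar x)
    (hψ : ∀ i, ∀ x ∈ closure Ω, |ψ i x| ≤ supNorm Ω (ψ i))
    (hcont : ∀ u ∈ paramSpace Ω ψ, ContinuousOn (slowness sStar sBar ψ u) (closure Ω))
    {T : paramSpace Ω ψ → EuclideanSpace ℝ (Fin d) → ℝ}
    (hT : ∀ u : paramSpace Ω ψ, IsEikonalSolution Ω x₀ (slowness sStar sBar ψ (u : ℕ → ℝ)) (T u))
    {x : EuclideanSpace ℝ (Fin d)} (hx : x ∈ closure Ω) : Measurable fun u => T u x := by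
  have hT' (J : ℕ) (u : paramSpace Ω ψ) :=
    hT ⟨truncParam J (u : ℕ → ℝ), truncParam_mem_paramSpace J _⟩
  refine measurable_of_tendsto_metrizable
    (fun J => (continuous_truncated_solution hΩ hsStar hψ hcont (hT' J) hx).measurable)
    (tendsto_pi_nhds.2 fun u => ?_)
  refine tendsto_of_exp_mul_bounds (tendsto_paramDist_truncParam u.2) (fun J => ?_) fun J => ?_
  · rw [paramDist_comm]
    exact (hT' J u).le_exp_paramDist_mul hΩ hsStar hψ hcont (truncParam_mem_paramSpace J _) u.2
      (hT u) hx
  · exact (hT u).le_exp_paramDist_mul hΩ hsStar hψ hcont u.2 (truncParam_mem_paramSpace J _)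
      (hT' J u) hx

end ForwardMap

/-! ### Moments of the truncation error. -/

section Moments

variable {d : ℕ} {Ω : Set (EuclideanSpace ℝ (Fin d))} {ψ : ℕ → EuclideanSpace ℝ (Fin d) → ℝ}

theorem summable_of_le_rpow_neg {p c : ℝ} (hp : 1 < p) {b : ℕ → ℝ} (hb0 : ∀ i, 0 ≤ b i)
    (hb : ∀ i : ℕ, b i ≤ c * ((i : ℝ) + 1) ^ (-p)) : Summable b := by
  have h1 : Summable fun i : ℕ => (i : ℝ) ^ (-p) := Real.summable_nat_rpow.2 (by linarith)
  have h2 := (summable_nat_add_iff 1).2 h1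
  push_cast at h2
  exact Summable.of_nonneg_of_le hb0 hb (h2.mul_left c)

theorem measurable_paramDist_zero :
    Measurable fun u : paramSpace Ω ψ => paramDist Ω ψ (u : ℕ → ℝ) 0 := by
  refine measurable_of_tendsto_metrizable (f := fun n (u : paramSpace Ω ψ) =>
    ∑ i ∈ Finset.range n, |(u : ℕ → ℝ) i - (0 : ℕ → ℝ) i| * supNorm Ω (ψ i)) (fun n => ?_)
    (tendsto_pi_nhds.2 fun u =>
      (summable_paramDist u.2 zero_mem_paramSpace).hasSum.tendsto_sum_nat)
  refine Finset.measurable_sum _ fun i _ => ?_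
  have : Measurable fun u : paramSpace Ω ψ => (u : ℕ → ℝ) i :=
    (measurable_pi_apply i).comp measurable_subtype_coe
  exact ((this.sub_const _).abs).mul_const _

/-- This trades the square for an exponential, so that Jensen's inequality applies while the factor
`ρ ^ 2` is kept. -/
theorem sq_mul_exp_le {x ρ a : ℝ} (hx : 0 ≤ x) (hρ : 0 < ρ) :
    x ^ 2 * Real.exp a ≤ ρ ^ 2 * Real.exp (2 / ρ * x + a) := by
  have h1 : x / ρ ≤ Real.exp (x / ρ) := by linarith [Real.add_one_le_exp (x / ρ)]
  have h2 : (x / ρ) ^ 2 ≤ Real.exp (2 / ρ * x) := by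
    calc (x / ρ) ^ 2 ≤ Real.exp (x / ρ) ^ 2 := by gcongr
      _ = Real.exp (2 / ρ * x) := by
        rw [← Real.exp_nat_mul]; congr 1; push_cast; ring
  calc x ^ 2 * Real.exp a = ρ ^ 2 * ((x / ρ) ^ 2 * Real.exp a) := by field_simp
    _ ≤ ρ ^ 2 * (Real.exp (2 / ρ * x) * Real.exp a) := by gcongr
    _ = _ := by rw [Real.exp_add]

/-- Moment bound for the truncation error, with exponential weights. -/
theorem integrable_exp_tail_and_integral_le (hb : Summable fun i => supNorm Ω (ψ i)) {J : ℕ}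
    {ρ : ℝ} (hρ : 0 < ρ)
    (htail : ∀ n, ∑ i ∈ Finset.range n, (if i < J then 0 else supNorm Ω (ψ i)) ≤ ρ) :
    Integrable (fun u : paramSpace Ω ψ =>
      Real.exp (2 / ρ * paramDist Ω ψ (u : ℕ → ℝ) (truncParam J (u : ℕ → ℝ))
        + 6 * paramDist Ω ψ (u : ℕ → ℝ) 0)) (prior Ω ψ) ∧
    ∫ u : paramSpace Ω ψ,
      Real.exp (2 / ρ * paramDist Ω ψ (u : ℕ → ℝ) (truncParam J (u : ℕ → ℝ))
        + 6 * paramDist Ω ψ (u : ℕ → ℝ) 0) ∂prior Ω ψ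
      ≤ ∫ x, Real.exp ((2 + 6 * ∑' i, supNorm Ω (ψ i)) * |x|) ∂gaussianReal 0 1 := by
  set b : ℕ → ℝ := fun i => supNorm Ω (ψ i) with hbdef
  have hb0 : ∀ i, 0 ≤ b i := fun i => supNorm_nonneg _
  set τ : ℕ → ℝ := fun i => if i < J then 0 else b i with hτ
  have hτ0 : ∀ i, 0 ≤ τ i := fun i => by
    by_cases h : i < J
    · simp [hτ, h]
    · simpa [hτ, h] using hb0 i
  have hτb : ∀ i, τ i ≤ b i := fun i => by
    by_cases h : i < J
    · simpa [hτ, h] using hb0 i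
    · simp [hτ, h]
  have hs (u : paramSpace Ω ψ) : Summable fun i => |(u : ℕ → ℝ) i| * b i := u.2
  have hsτ (u : paramSpace Ω ψ) : Summable fun i => |(u : ℕ → ℝ) i| * τ i :=
    (hs u).of_nonneg_of_le (fun i => mul_nonneg (abs_nonneg _) (hτ0 i))
      fun i => mul_le_mul_of_nonneg_left (hτb i) (abs_nonneg _)
  have hrw (u : paramSpace Ω ψ) (i : ℕ) : |(u : ℕ → ℝ) i| * (2 / ρ * τ i + 6 * b i)
      = 2 / ρ * (|(u : ℕ → ℝ) i| * τ i) + 6 * (|(u : ℕ → ℝ) i| * b i) := by ring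
  have hexp (u : paramSpace Ω ψ) :
      2 / ρ * paramDist Ω ψ (u : ℕ → ℝ) (truncParam J (u : ℕ → ℝ))
        + 6 * paramDist Ω ψ (u : ℕ → ℝ) 0
      = ∑' i, |(u : ℕ → ℝ) i| * (2 / ρ * τ i + 6 * b i) := by
    rw [paramDist_truncParam_eq, paramDist_self_zero_eq, ← tsum_mul_left, ← tsum_mul_left,
      ← ((hsτ u).mul_left _).tsum_add ((hs u).mul_left _)]
    exact tsum_congr fun i => (hrw u i).symm
  simp only [hexp]
  -- The tail weights sum to at most `ρ`, so the factor `2 / ρ` contributes at most `2` to the total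
  -- weight, whatever `J` is.
  refine integrable_exp_tsum_prior hb (w := fun i => 2 / ρ * τ i + 6 * b i)
    (fun i => add_nonneg (mul_nonneg (by positivity) (hτ0 i))
      (mul_nonneg (by norm_num) (hb0 i)))
    (add_pos_of_pos_of_nonneg two_pos (mul_nonneg (by norm_num) (tsum_nonneg hb0)))
    (fun n => ?_) fun u => ?_
  · rw [Finset.sum_add_distrib, ← Finset.mul_sum, ← Finset.mul_sum]
    have h1 : 2 / ρ * ∑ i ∈ Finset.range n, τ i ≤ 2 / ρ * ρ :=
      mul_le_mul_of_nonneg_left (htail n) (by positivity)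
    rw [div_mul_cancel₀ _ hρ.ne'] at h1
    have h2 : ∑ i ∈ Finset.range n, b i ≤ ∑' i, b i := hb.sum_le_tsum _ fun i _ => hb0 i
    linarith
  · simp only [hrw]
    exact ((hsτ u).mul_left _).add ((hs u).mul_left _)

end Moments

end LogNormalEikonal
end

/-! ### Assembly of the convergence rate. -/

open LogNormalEikonal MeasureTheory ProbabilityTheory

theorem mainTheorem4 {d N : ℕ} (Ω : Set (EuclideanSpace ℝ (Fin d)))
    (hΩ : LogNormalEikonal.IsLipschitzDomain Ω)
    (x₀ : EuclideanSpace ℝ (Fin d)) (hx₀ : x₀ ∈ Ω)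
    (sStar sBar : EuclideanSpace ℝ (Fin d) → ℝ) (ψ : ℕ → EuclideanSpace ℝ (Fin d) → ℝ)
    (hsStar : MeasureTheory.MemLp sStar ⊤ (MeasureTheory.volume.restrict Ω))
    (hsStar_nonneg : ∀ x ∈ closure Ω, 0 ≤ sStar x)
    (hsBar : MeasureTheory.MemLp sBar ⊤ (MeasureTheory.volume.restrict Ω))
    (hψ : ∀ i, MeasureTheory.MemLp (ψ i) ⊤ (MeasureTheory.volume.restrict Ω))
    (hcont : ∀ u ∈ LogNormalEikonal.paramSpace Ω ψ,
      ContinuousOn (LogNormalEikonal.slowness sStar sBar ψ u) (closure Ω))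
    (c p : ℝ) (hc : 0 < c) (hp : 1 < p)
    (hdecay : ∀ i : ℕ, LogNormalEikonal.supNorm Ω (ψ i) ≤ c * ((i : ℝ) + 1) ^ (-p))
    (T : LogNormalEikonal.paramSpace Ω ψ → EuclideanSpace ℝ (Fin d) → ℝ)
    (hT : ∀ u : LogNormalEikonal.paramSpace Ω ψ, LogNormalEikonal.IsEikonalSolution Ω x₀
      (LogNormalEikonal.slowness sStar sBar ψ (u : ℕ → ℝ)) (T u))
    (TJ : ℕ → LogNormalEikonal.paramSpace Ω ψ → EuclideanSpace ℝ (Fin d) → ℝ)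
    (hTJ : ∀ (J : ℕ) (u : LogNormalEikonal.paramSpace Ω ψ), 1 ≤ J →
      LogNormalEikonal.IsEikonalSolution Ω x₀
        (LogNormalEikonal.truncSlowness sStar sBar ψ J (u : ℕ → ℝ)) (TJ J u))
    (pts : Fin N → EuclideanSpace ℝ (Fin d)) (hpts : ∀ k, pts k ∈ closure Ω)
    (cov : Matrix (Fin N) (Fin N) ℝ) (hcov : cov.PosDef) :
    ∀ r : ℝ, ∃ C : ℝ, ∀ δ : EuclideanSpace ℝ (Fin N), ‖δ‖ < r → ∀ J : ℕ, 1 ≤ J →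
      MeasureTheory.IsProbabilityMeasure
        (LogNormalEikonal.posterior (LogNormalEikonal.prior Ω ψ)
          (LogNormalEikonal.potential cov (LogNormalEikonal.forwardMap pts T) δ)) ∧
      MeasureTheory.IsProbabilityMeasure
        (LogNormalEikonal.posterior (LogNormalEikonal.prior Ω ψ)
          (LogNormalEikonal.potential cov (LogNormalEikonal.forwardMap pts (TJ J)) δ)) ∧
      LogNormalEikonal.hellingerDist (LogNormalEikonal.prior Ω ψ)
        (LogNormalEikonal.posterior (LogNormalEikonal.prior Ω ψ)
          (LogNormalEikonal.potential cov (LogNormalEikonal.forwardMap pts (TJ J)) δ))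
        (LogNormalEikonal.posterior (LogNormalEikonal.prior Ω ψ)
          (LogNormalEikonal.potential cov (LogNormalEikonal.forwardMap pts T) δ))
        ≤ C * (J : ℝ) ^ (-(p - 1)) := by
  have hψ' : ∀ i, ∀ x ∈ closure Ω, |ψ i x| ≤ supNorm Ω (ψ i) := fun i x hx =>
    abs_le_supNorm_of_continuousOn_slowness hΩ.isOpen hsBar hψ hcont i hx
  have hb : Summable fun i => supNorm Ω (ψ i) :=
    summable_of_le_rpow_neg hp (fun i => supNorm_nonneg _) hdecay
  have := isProbabilityMeasure_prior hb
  have hTJ' : ∀ (J : ℕ) (u : paramSpace Ω ψ), 1 ≤ J → IsEikonalSolution Ω x₀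
      (slowness sStar sBar ψ (truncParam J (u : ℕ → ℝ))) (TJ J u) := fun J u hJ => by
    rw [slowness_truncParam]; exact hTJ J u hJ
  intro r
  rcases le_or_gt r 0 with hr | hr
  · exact ⟨0, fun δ hδ => absurd (norm_nonneg δ) (not_le.2 (hδ.trans_le hr))⟩
  set T₀ := T ⟨0, zero_mem_paramSpace⟩ with hT₀def
  have hT₀ : IsEikonalSolution Ω x₀ (slowness sStar sBar ψ 0) T₀ := hT ⟨0, zero_mem_paramSpace⟩
  set K : ℝ := ∑ k, |T₀ (pts k)| with hK
  have hK0 : 0 ≤ K := Finset.sum_nonneg fun _ _ => abs_nonneg _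
  have hT₀K : ∀ k, |T₀ (pts k)| ≤ K := fun k =>
    Finset.single_le_sum (f := fun k => |T₀ (pts k)|) (fun _ _ => abs_nonneg _)
      (Finset.mem_univ k)
  set A : paramSpace Ω ψ → ℝ := fun u => paramDist Ω ψ (u : ℕ → ℝ) 0 with hA
  have hA0 : ∀ u, 0 ≤ A u := fun u => paramDist_nonneg _ _
  have hTbd : ∀ u k, |T u (pts k)| ≤ K * Real.exp (A u) := fun u k =>
    ((hT u).abs_le_mul_exp hΩ hsStar_nonneg hψ' hcont u.2 hT₀ (hpts k)).trans
      (mul_le_mul_of_nonneg_right (hT₀K k) (Real.exp_pos _).le)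
  have hTJbd : ∀ J, 1 ≤ J → ∀ u k, |TJ J u (pts k)| ≤ K * Real.exp (A u) := fun J hJ u k =>
    ((hTJ' J u hJ).abs_le_mul_exp hΩ hsStar_nonneg hψ' hcont (truncParam_mem_paramSpace J _)
      hT₀ (hpts k)).trans
      (mul_le_mul (hT₀K k) (Real.exp_le_exp.2 (paramDist_truncParam_zero_le u.2 J))
        (Real.exp_pos _).le hK0)
  have hdiff : ∀ J, 1 ≤ J → ∀ u k, |TJ J u (pts k) - T u (pts k)|
      ≤ K * Real.exp (A u) * (paramDist Ω ψ (u : ℕ → ℝ) (truncParam J (u : ℕ → ℝ))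
        * Real.exp (A u)) := fun J hJ u k => by
    have hexp : K * Real.exp (A u) * (paramDist Ω ψ (u : ℕ → ℝ) (truncParam J (u : ℕ → ℝ))
        * Real.exp (paramDist Ω ψ (u : ℕ → ℝ) (truncParam J (u : ℕ → ℝ))))
        ≤ K * Real.exp (A u) * (paramDist Ω ψ (u : ℕ → ℝ) (truncParam J (u : ℕ → ℝ))
        * Real.exp (A u)) := by
      refine mul_le_mul_of_nonneg_left ?_ (mul_nonneg hK0 (Real.exp_pos _).le)
      exact mul_le_mul_of_nonneg_left (Real.exp_le_exp.2 (paramDist_truncParam_le u.2 J))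
        (paramDist_nonneg _ _)
    refine abs_sub_le_iff.2 ⟨?_, ?_⟩
    · have h := (hTJ' J u hJ).sub_le_mul_paramDist hΩ hsStar_nonneg hψ' hcont
        (truncParam_mem_paramSpace J _) u.2 (hT u) (hpts k) (hTbd u k)
      rw [paramDist_comm] at h
      exact h.trans hexp
    · exact ((hT u).sub_le_mul_paramDist hΩ hsStar_nonneg hψ' hcont u.2
        (truncParam_mem_paramSpace J _) (hTJ' J u hJ) (hpts k) (hTJbd J hJ u k)).trans hexp
  set Q := precisionSum cov with hQ
  have hQ0 : 0 ≤ Q := precisionSum_nonneg cov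
  -- `H` dominates both potentials for all `J ≥ 1` and all `‖δ‖ < r`, so `z` is a uniform positive
  -- lower bound for the normalising constants.
  set H : paramSpace Ω ψ → ℝ := fun u =>
    1 / 2 * (Q * (((r + K) * Real.exp (A u)) * ((r + K) * Real.exp (A u)))) with hH
  have hHmeas : Measurable H := by
    have h1 : Measurable A := measurable_paramDist_zero
    have h2 := Real.measurable_exp.comp h1
    exact ((((h2.const_mul (r + K)).mul (h2.const_mul (r + K))).const_mul Q).const_mul (1 / 2))
  have hHint : Integrable (fun u => Real.exp (-H u)) (prior Ω ψ) :=
    integrable_exp_neg hHmeas.aestronglyMeasurable fun u => by positivity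
  set z := ∫ u, Real.exp (-H u) ∂prior Ω ψ with hz
  have hz0 : 0 < z := integral_exp_pos hHint
  set M := ∫ x, Real.exp ((2 + 6 * ∑' i, supNorm Ω (ψ i)) * |x|) ∂gaussianReal 0 1 with hM
  set P := Q * ((r + K) * K) with hP
  have hP0 : 0 ≤ P := mul_nonneg hQ0 (mul_nonneg (add_nonneg hr.le hK0) hK0)
  -- The factor `c / (p - 1)` is `ρ` without its power of `J`; the rest comes from the Hellinger
  -- estimate with second moment `(P * ρ) ^ 2 * M`.
  refine ⟨√(1 / (8 * z) * M) * (P * (c / (p - 1))), fun δ hδ J hJ => ?_⟩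
  have hδk : ∀ k, |δ k| ≤ r := fun k => by
    simpa using (PiLp.norm_apply_le δ k).trans hδ.le
  have hres {τ : EuclideanSpace ℝ (Fin d) → ℝ} {u : paramSpace Ω ψ} {k : Fin N}
      (h : |τ (pts k)| ≤ K * Real.exp (A u)) :
      |δ k - τ (pts k)| ≤ (r + K) * Real.exp (A u) := by
    have h1 : r ≤ r * Real.exp (A u) := le_mul_of_one_le_right hr.le (Real.one_le_exp (hA0 u))
    linarith [abs_sub (δ k) (τ (pts k)), hδk k]
  have hmT (k) : Measurable fun u => forwardMap pts T u k :=
    measurable_solution hΩ hsStar_nonneg hψ' hcont hT (hpts k)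
  have hmTJ (k) : Measurable fun u => forwardMap pts (TJ J) u k :=
    (continuous_truncated_solution hΩ hsStar_nonneg hψ' hcont (fun u => hTJ' J u hJ)
      (hpts k)).measurable
  have hmΦ := measurable_potential cov hmT δ
  have hmΦJ := measurable_potential cov hmTJ δ
  have hΦ0 := potential_nonneg hcov (forwardMap pts T) δ
  have hΦJ0 := potential_nonneg hcov (forwardMap pts (TJ J)) δ
  refine ⟨isProbabilityMeasure_posterior hmΦ hΦ0, isProbabilityMeasure_posterior hmΦJ hΦJ0, ?_⟩
  have hzΦ : z ≤ ∫ u, Real.exp (-potential cov (forwardMap pts T) δ u) ∂prior Ω ψ :=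
    integral_mono hHint (integrable_exp_neg hmΦ.aestronglyMeasurable hΦ0) fun u =>
      Real.exp_le_exp.2 (neg_le_neg (potential_le cov fun k => hres (hTbd u k)))
  have hzΦJ : z ≤ ∫ u, Real.exp (-potential cov (forwardMap pts (TJ J)) δ u) ∂prior Ω ψ :=
    integral_mono hHint (integrable_exp_neg hmΦJ.aestronglyMeasurable hΦJ0) fun u =>
      Real.exp_le_exp.2 (neg_le_neg (potential_le cov fun k => hres (hTJbd J hJ u k)))
  have hJ0 : (0 : ℝ) < J := by exact_mod_cast hJ
  set ρ : ℝ := c / (p - 1) * (J : ℝ) ^ (-(p - 1)) with hρ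
  have hρ0 : 0 < ρ := mul_pos (div_pos hc (by linarith)) (Real.rpow_pos_of_pos hJ0 _)
  obtain ⟨hEint, hEle⟩ := integrable_exp_tail_and_integral_le hb hρ0
    (sum_range_tail_le hp hc hdecay hJ)
  have hsq (u : paramSpace Ω ψ) : (potential cov (forwardMap pts (TJ J)) δ u
      - potential cov (forwardMap pts T) δ u) ^ 2 ≤ (P * ρ) ^ 2 *
      Real.exp (2 / ρ * paramDist Ω ψ (u : ℕ → ℝ) (truncParam J (u : ℕ → ℝ)) + 6 * A u) := by
    have h1 := abs_potential_sub_le cov (G := forwardMap pts (TJ J)) (G' := forwardMap pts T)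
      (δ := δ) (u := u) (fun k => hres (hTJbd J hJ u k)) (fun k => hres (hTbd u k))
      fun k => hdiff J hJ u k
    set R := paramDist Ω ψ (u : ℕ → ℝ) (truncParam J (u : ℕ → ℝ)) with hR
    have hR0 : 0 ≤ R := paramDist_nonneg _ _
    -- The residual contributes one factor `exp (A u)` and the travel-time difference two; squaring
    -- gives six.
    have h2 : Real.exp (6 * A u) = Real.exp (A u) ^ 6 := by
      rw [← Real.exp_nat_mul]; norm_num
    calc _ ≤ (Q * ((r + K) * Real.exp (A u) * (K * Real.exp (A u) * (R * Real.exp (A u))))) ^ 2 :=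
          sq_le_sq' (neg_le_of_abs_le h1) (le_of_abs_le h1)
      _ = P ^ 2 * (R ^ 2 * Real.exp (6 * A u)) := by rw [h2, hP]; ring
      _ ≤ P ^ 2 * (ρ ^ 2 * Real.exp (2 / ρ * R + 6 * A u)) :=
          mul_le_mul_of_nonneg_left (sq_mul_exp_le hR0 hρ0) (sq_nonneg _)
      _ = _ := by ring
  have hint : Integrable (fun u => (potential cov (forwardMap pts (TJ J)) δ u
      - potential cov (forwardMap pts T) δ u) ^ 2) (prior Ω ψ) := by
    refine (hEint.const_mul ((P * ρ) ^ 2)).mono'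
      ((hmΦJ.sub hmΦ).pow_const 2).aestronglyMeasurable (Filter.Eventually.of_forall fun u => ?_)
    rw [Real.norm_of_nonneg (sq_nonneg _)]
    exact hsq u
  have hMle : ∫ u, (potential cov (forwardMap pts (TJ J)) δ u
      - potential cov (forwardMap pts T) δ u) ^ 2 ∂prior Ω ψ ≤ (P * ρ) ^ 2 * M := by
    refine (integral_mono hint (hEint.const_mul ((P * ρ) ^ 2)) hsq).trans ?_
    rw [integral_const_mul]
    exact mul_le_mul_of_nonneg_left hEle (sq_nonneg _)
  refine (hellingerDist_posterior_le hmΦJ hmΦ hΦJ0 hΦ0 hz0 hzΦJ hzΦ hint hMle).trans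
    (le_of_eq ?_)
  rw [← mul_assoc, mul_comm _ ((P * ρ) ^ 2), mul_assoc, Real.sqrt_mul (sq_nonneg _),
    Real.sqrt_sq (mul_nonneg hP0 hρ0.le), hρ]
  ring
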